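/- Let $\ell\ge 5$ be a prime. Let $L=(L,b)$ be an even lattice, i.e. a free $\mathbb Z$-module $L$ of finite rank with a symmetric positive definite bilinear form $b$ such that $b(x,x)\in 2\mathbb Z$ for all $x\in L$; write its rank as $2k$ (a priori $k\in\frac12\mathbb Z$). Let $L^\#=\{y\in\mathbb Q\otimes L : b(y,L)\subset\mathbb Z\}$ be the dual lattice, $\mathrm{Det}(L)=L^\#/L$, and $q:\mathrm{Det}(L)\to\mathbb Q/\mathbb Z$ the quadratic form induced by $x\mapsto\frac12 b(x,x)$. Let $s$ be the level of $L$, i.e. the smallest positive integer such that $sG^{-1}$ is integral with even diagonal, $G$ being a Gram matrix of $L$. Put $\chi_L=\sum_{\rho\in\mathrm{Det}(L)}e^{2\pi i q(\rho)}$ and $O_L=\mathbb Z[e^{2\pi i/s},1/\chi_L]\subset\mathbb C$. For $z$ in the complex upper half plane, put $\theta_L(z)=\sum_{x\in L}e^{\pi i b(x,x)z}$ and $\theta_\rho(z)=\sum_{x\in\rho}e^{\pi i b(x,x)z}$ for $\rho\in\mathrm{Det}(L)$, and let $W_L$ be the $O_L$-module of functions on the upper half plane spanned by the $\theta_\rho$,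 $\rho\in\mathrm{Det}(L)$. Suppose that $L$ has an automorphism $\sigma$ (a $\mathbb Z$-linear bijection of $L$ preserving $b$) whose order is a power of $\ell$ and such that $\mathrm{Det}(L)^\sigma=0$, i.e. $0$ is the only element of $\mathrm{Det}(L)$ fixed by the action of $\sigma$ on $\mathrm{Det}(L)$ induced by linear extension. Then $k$ is an even integer, and $$\theta_L|_kA\equiv\theta_L \bmod \ell W_L$$ for all $A\in SL_2(\mathbb Z)$, where $\big(f|_k\left(\begin{smallmatrix}a&b\\c&d\end{smallmatrix}\right)\big)(z)=f\big(\frac{az+b}{cz+d}\big)(cz+d)^{-k}$. -/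

import Mathlib

open scoped TensorProduct MatrixGroups ModularForm UpperHalfPlane

/-- An even lattice with underlying free `ℤ`-module `L` of finite rank: a symmetric positive
definite bilinear form `b` with `b(x,x)` even for all `x`. (By polarization, such a form takes
integral values.) -/
structure EvenLattice (L : Type*) [AddCommGroup L] [Module.Free ℤ L] [Module.Finite ℤ L] where
  /-- the bilinear form -/
  form : LinearMap.BilinForm ℤ L
  symm : ∀ x y, form x y = form y x
  posDef : ∀ x, x ≠ 0 → 0 < form x x
  even : ∀ x, Even (form x x)

noncomputable section

namespace EvenLattice

variable {L : Type*} [AddCommGroup L] [Module.Free ℤ L] [Module.Finite ℤ L] (Λ : EvenLattice L)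

/-- The `ℚ`-bilinear extension of `b` to `ℚ ⊗ L`. -/
def formQ : LinearMap.BilinForm ℚ (ℚ ⊗[ℤ] L) := LinearMap.BilinForm.baseChange ℚ Λ.form

theorem formQ_tmul (a c : ℚ) (x y : L) :
    Λ.formQ (a ⊗ₜ[ℤ] x) (c ⊗ₜ[ℤ] y) = a * c * (Λ.form x y : ℚ) := by
  simp [formQ, LinearMap.BilinForm.baseChange_tmul, mul_comm]

theorem formQ_symm (x y : ℚ ⊗[ℤ] L) : Λ.formQ x y = Λ.formQ y x := by
  induction x with
  | zero => simp
  | add a b ha hb => simp only [map_add, LinearMap.add_apply, ha, hb]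
  | tmul a v =>
    induction y with
    | zero => simp
    | add a b ha hb => simp only [map_add, LinearMap.add_apply, ha, hb]
    | tmul c w => rw [formQ_tmul, formQ_tmul, Λ.symm, mul_comm a c]

/-- The image of `L` in `ℚ ⊗ L`. -/
def latticeQ (_ : EvenLattice L) : AddSubgroup (ℚ ⊗[ℤ] L) :=
  (TensorProduct.mk ℤ ℚ L 1).toAddMonoidHom.range

/-- The dual lattice: all `y` in `ℚ ⊗ L` with `b(y, x) ∈ ℤ` for all `x` in `L`. -/
def dual : AddSubgroup (ℚ ⊗[ℤ] L) where
  carrier := {y | ∀ x : L, ∃ m : ℤ, Λ.formQ y ((1 : ℚ) ⊗ₜ[ℤ] x) = m}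
  zero_mem' := fun _ => ⟨0, by simp⟩
  add_mem' := fun {y y'} hy hy' x => by
    obtain ⟨m, hm⟩ := hy x
    obtain ⟨n, hn⟩ := hy' x
    exact ⟨m + n, by simp [hm, hn]⟩
  neg_mem' := fun {y} hy x => by
    obtain ⟨m, hm⟩ := hy x
    exact ⟨-m, by simp [hm]⟩

/-- The determinant module, i.e. the quotient of the dual lattice by `L`. -/
abbrev Det : Type _ := Λ.dual ⧸ (Λ.latticeQ.addSubgroupOf Λ.dual)

/-- The discriminant quadratic form `Det(L) → ℚ/ℤ`, induced by `x ↦ b(x,x)/2`. -/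
def discForm : Λ.Det → AddCircle (1 : ℚ) :=
  Quotient.lift (fun x : Λ.dual => ((Λ.formQ x x / 2 : ℚ) : AddCircle (1 : ℚ))) (by
    intro x y hxy
    have h : -x + y ∈ Λ.latticeQ.addSubgroupOf Λ.dual := QuotientAddGroup.leftRel_apply.1 hxy
    obtain ⟨v, hv⟩ : ∃ v : L, (1 : ℚ) ⊗ₜ[ℤ] v = -(x : ℚ ⊗[ℤ] L) + y := h
    obtain ⟨m, hm⟩ := x.2 v
    obtain ⟨e, he⟩ := Λ.even v
    have hy : (y : ℚ ⊗[ℤ] L) = x + (1 : ℚ) ⊗ₜ[ℤ] v := by rw [hv]; abel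
    have hq : Λ.formQ y y = Λ.formQ x x + 2 * (m + e) := by
      rw [hy]
      simp only [map_add, LinearMap.add_apply]
      rw [Λ.formQ_symm ((1 : ℚ) ⊗ₜ[ℤ] v) x, hm, formQ_tmul, he]
      push_cast
      ring
    change ((Λ.formQ x x / 2 : ℚ) : AddCircle (1 : ℚ)) = ((Λ.formQ y y / 2 : ℚ) : AddCircle (1 : ℚ))
    rw [eq_comm, ← sub_eq_zero, ← AddCircle.coe_sub, AddCircle.coe_eq_zero_iff]
    refine ⟨m + e, ?_⟩
    rw [hq]
    simp only [zsmul_eq_mul]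
    push_cast
    ring)

/-- The character `t ↦ exp(2πi t)` of `ℚ/ℤ`. -/
def expChar : AddCircle (1 : ℚ) → ℂ :=
  Function.Periodic.lift (f := fun t : ℚ => Complex.exp (2 * Real.pi * Complex.I * (t : ℂ)))
    (c := 1) (by
      intro t
      simp only
      push_cast
      rw [mul_add, mul_one, Complex.exp_add, Complex.exp_two_pi_mul_I, mul_one])

/-- The Gauss sum `χ_L`, the sum of `exp(2πi q(ρ))` over the (finite) group `Det(L)`. -/
def gaussSum : ℂ := ∑ᶠ ρ : Λ.Det, expChar (Λ.discForm ρ)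

/-- The Gram matrix of `L` with respect to a `ℤ`-basis, as a rational matrix. -/
def gram : Matrix (Fin (Module.finrank ℤ L)) (Fin (Module.finrank ℤ L)) ℚ :=
  Matrix.of fun i j => (Λ.form (Module.finBasis ℤ L i) (Module.finBasis ℤ L j) : ℚ)

/-- The level: the smallest positive integer `l` such that `l G⁻¹` is an integral matrix with even
integers on its diagonal, `G` being the Gram matrix (the choice of the basis is irrelevant). -/
def level : ℕ :=
  sInf {l : ℕ | 0 < l ∧ ∃ M : Matrix (Fin (Module.finrank ℤ L)) (Fin (Module.finrank ℤ L)) ℤ,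
    (l : ℚ) • Λ.gram⁻¹ = M.map (fun m : ℤ => (m : ℚ)) ∧ ∀ i, Even (M i i)}

/-- The ring `O_L = ℤ[ζ, 1/χ_L]`, where `ζ = exp(2πi/s)` and `s` is the level of `L`. -/
def coeffRing : Subalgebra ℤ ℂ :=
  Algebra.adjoin ℤ {Complex.exp (2 * Real.pi * Complex.I / (Λ.level : ℂ)), Λ.gaussSum⁻¹}

/-- The theta series `θ_L = ∑_{x ∈ L} q^{b(x,x)/2}`, where `q^t = exp(2πi t z)`. -/
def theta (z : ℍ) : ℂ :=
  ∑' x : L, Complex.exp (2 * Real.pi * Complex.I * ((Λ.form x x : ℂ) / 2) * (z : ℂ))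

/-- The theta series `θ_ρ = ∑_{x ∈ ρ} q^{b(x,x)/2}` of a coset `ρ` of `L` in its dual. -/
def cosetTheta (ρ : Λ.Det) (z : ℍ) : ℂ :=
  ∑' x : {x : Λ.dual // (x : Λ.Det) = ρ},
    Complex.exp (2 * Real.pi * Complex.I *
      (((Λ.formQ (x : Λ.dual) (x : Λ.dual) : ℚ) : ℂ) / 2) * (z : ℂ))

/-- The `O_L`-module `W_L` spanned by the `θ_ρ`, viewed as functions on the upper half plane. -/
def thetaSpan : Submodule Λ.coeffRing (ℍ → ℂ) :=
  Submodule.span Λ.coeffRing (Set.range Λ.cosetTheta)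

/-- The group of automorphisms of the lattice. -/
def autGroup : Subgroup (L ≃ₗ[ℤ] L) where
  carrier := {σ | ∀ x y, Λ.form (σ x) (σ y) = Λ.form x y}
  one_mem' := fun _ _ => rfl
  mul_mem' := fun {σ τ} hσ hτ x y => (hσ (τ x) (τ y)).trans (hτ x y)
  inv_mem' := fun {σ} hσ x y => by
    have h := hσ (σ.symm x) (σ.symm y)
    rw [LinearEquiv.apply_symm_apply, LinearEquiv.apply_symm_apply] at h
    exact h.symm

variable {Λ}

/-- The linear extension of an automorphism to `ℚ ⊗ L`. -/
def autQ (σ : Λ.autGroup) : ℚ ⊗[ℤ] L →ₗ[ℚ] ℚ ⊗[ℤ] L :=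
  LinearMap.baseChange ℚ ((σ : L ≃ₗ[ℤ] L) : L →ₗ[ℤ] L)

theorem autQ_tmul (σ : Λ.autGroup) (a : ℚ) (x : L) :
    autQ σ (a ⊗ₜ[ℤ] x) = a ⊗ₜ[ℤ] (σ : L ≃ₗ[ℤ] L) x := rfl

theorem formQ_autQ (σ : Λ.autGroup) (y : ℚ ⊗[ℤ] L) (x : L) :
    Λ.formQ (autQ σ y) ((1 : ℚ) ⊗ₜ[ℤ] (σ : L ≃ₗ[ℤ] L) x) = Λ.formQ y ((1 : ℚ) ⊗ₜ[ℤ] x) := by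
  induction y with
  | zero => simp
  | add a b ha hb => simp only [map_add, LinearMap.add_apply, ha, hb]
  | tmul a v => rw [autQ_tmul, formQ_tmul, formQ_tmul, σ.2 v x]

theorem autQ_mem_dual (σ : Λ.autGroup) (y : ℚ ⊗[ℤ] L) (hy : y ∈ Λ.dual) :
    autQ σ y ∈ Λ.dual := by
  intro x
  obtain ⟨m, hm⟩ := hy ((σ : L ≃ₗ[ℤ] L).symm x)
  refine ⟨m, ?_⟩
  rw [← hm, ← formQ_autQ σ y, LinearEquiv.apply_symm_apply]

/-- The action of an automorphism on the dual lattice. -/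
def autDual (σ : Λ.autGroup) : Λ.dual →+ Λ.dual :=
  ((autQ σ).toAddMonoidHom.comp Λ.dual.subtype).codRestrict Λ.dual
    fun y => autQ_mem_dual σ y y.2

/-- The action of an automorphism on `Det(L)`. -/
def autDet (σ : Λ.autGroup) : Λ.Det →+ Λ.Det :=
  QuotientAddGroup.map _ _ (autDual σ) (by
    rintro ⟨y, hy⟩ ⟨v, hv⟩
    refine ⟨(σ : L ≃ₗ[ℤ] L) v, ?_⟩
    have hv' : (1 : ℚ) ⊗ₜ[ℤ] v = y := hv
    change (1 : ℚ) ⊗ₜ[ℤ] (σ : L ≃ₗ[ℤ] L) v = autQ σ y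
    rw [← hv', autQ_tmul])

/-- The subgroup `Det(L)^σ` of elements of `Det(L)` fixed by `σ`. -/
def detFixed (σ : Λ.autGroup) : AddSubgroup Λ.Det :=
  (autDet σ).eqLocus (AddMonoidHom.id Λ.Det)

end EvenLattice

end

/-! The action of `σ` on the finite group Det(L) has 0 as its only fixed point, and its order is a
power of ℓ. All other orbits therefore have length divisible by ℓ, so every `σ`-invariant sum over
Det(L), with values in any abelian group, equals its term at 0 up to ℓ times an element of that
group (`sum_eq_add_nsmul_of_perm`, `sum_det_eq`). Everything arithmetic follows from this count,
applied to different summands.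

The analytic input is the theta transformation. T multiplies θ_ρ by e(q(ρ)). By Poisson summation
(`exists_cosetTheta_S`), S sends θ_ρ to a constant C > 0 times the rank-th power of a root of -iz
times ∑ e(b(ρ,μ)) θ_μ. The constant is not computed from a covolume. The relations S² = 1 and S =
TSTST on the half plane, followed by the limit at i∞, give C²|Det(L)| = 1 and (-i)^n (Cχ)² = 1,
where n is the rank and χ the Gauss sum.

Hence (-i)^n χ² = |Det(L)|. The orbit count gives χ ≡ 1 and |Det(L)| ≡ 1 modulo ℓ among algebraic
integers, so (-i)^n ≡ 1, and this forces 4 ∣ n because ℓ does not divide 2. So k = n/2 is even, the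
root becomes an honest power of z, and S acts by χ⁻¹ ∑ e(b(ρ,μ)) θ_μ, with coefficients in O_L.

For the congruence, consider the combinations ∑ c_ρ θ_ρ with `σ`-invariant c in O_L and c_0 ≡ 1 mod
ℓ (`IsNormalized`). They are stable under T and, by the orbit count for c and for χ, under S, hence
under SL₂(ℤ). The orbit count in W_L itself shows that each of them is congruent to θ_L. -/

/-! ### Gaussian series in one variable, fixed-point counting, integrality -/

theorem HasSum.mul_complex {α β : Type*} {F : α → ℂ} {G : β → ℂ} {s t : ℂ} (hF : HasSum F s)
    (hG : HasSum G t) : HasSum (fun p : α × β => F p.1 * G p.2) (s * t) :=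
  hF.mul hG (summable_mul_of_summable_norm hF.summable.norm hG.summable.norm)

theorem hasSum_prod_apply_fin {n : ℕ} (f : Fin n → ℤ → ℂ) (hf : ∀ i, Summable (f i)) :
    HasSum (fun a : Fin n → ℤ => ∏ i, f i (a i)) (∏ i, ∑' m, f i m) := by
  induction n with
  | zero => simp
  | succ n ih =>
    have h3 := (hf 0).hasSum.mul_complex (ih (fun i => f i.succ) fun i => hf i.succ)
    rw [Fin.prod_univ_succ, ← (Fin.consEquiv fun _ : Fin (n + 1) => ℤ).hasSum_iff]
    refine h3.congr_fun fun p => ?_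
    simp [Fin.prod_univ_succ, Fin.consEquiv]

/-- A translated one-dimensional Gaussian series and its Poisson transform. -/
theorem tsum_exp_sq_translate {d : ℕ} (hd : 0 < d) (x : ℝ) {τ : ℂ} (hτ : 0 < τ.im) :
    Summable (fun a : ℤ => Complex.exp (Real.pi * Complex.I * d * (x + a) ^ 2 * (-τ⁻¹))) ∧
    Summable (fun a : ℤ => Complex.exp (2 * Real.pi * Complex.I * (a * x) +
        Real.pi * Complex.I * (a ^ 2 / d) * τ)) ∧
    ∑' a : ℤ, Complex.exp (Real.pi * Complex.I * d * (x + a) ^ 2 * (-τ⁻¹)) =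
      (((d : ℝ) ^ (1 / 2 : ℝ) : ℝ) : ℂ)⁻¹ * ((Complex.I / τ) ^ (1 / 2 : ℂ))⁻¹ *
        ∑' a : ℤ, Complex.exp (2 * Real.pi * Complex.I * (a * x) +
          Real.pi * Complex.I * (a ^ 2 / d) * τ) := by
  have hd0 : (d : ℂ) ≠ 0 := by exact_mod_cast hd.ne'
  have hτ0 : τ ≠ 0 := by rintro rfl; simp at hτ
  have hdr : (0 : ℝ) < d := by exact_mod_cast hd
  set t : ℂ := d * (-τ⁻¹) with ht
  have ht0 : t ≠ 0 := mul_ne_zero hd0 (neg_ne_zero.2 (inv_ne_zero hτ0))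
  have him : 0 < t.im := by
    rw [ht, ← Complex.ofReal_natCast, Complex.im_ofReal_mul, Complex.neg_im, Complex.inv_im]
    have := Complex.normSq_pos.2 hτ0
    rw [neg_div, neg_neg]
    positivity
  have him' : 0 < (τ / d).im := by
    rw [← Complex.ofReal_natCast, Complex.div_ofReal_im]; positivity
  have hl : ∀ a : ℤ, Complex.exp (Real.pi * Complex.I * d * (x + a) ^ 2 * (-τ⁻¹)) =
      Complex.exp (Real.pi * Complex.I * x ^ 2 * t) * jacobiTheta₂_term a (x * t) t := by
    intro a
    rw [jacobiTheta₂_term, ← Complex.exp_add, ht]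
    congr 1; ring
  have hr : ∀ a : ℤ, Complex.exp (2 * Real.pi * Complex.I * (a * x) +
      Real.pi * Complex.I * (a ^ 2 / d) * τ) = jacobiTheta₂_term a x (τ / d) := by
    intro a
    rw [jacobiTheta₂_term]
    congr 1; ring
  simp_rw [hl, hr]
  refine ⟨((summable_jacobiTheta₂_term_iff _ _).2 him).mul_left _,
    (summable_jacobiTheta₂_term_iff _ _).2 him', ?_⟩
  rw [tsum_mul_left]
  change _ * jacobiTheta₂ _ _ = _ * jacobiTheta₂ _ _
  rw [jacobiTheta₂_functional_equation, mul_div_assoc (x : ℂ), div_self ht0, mul_one]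
  have e1 : -1 / t = τ / d := by rw [ht]; field_simp
  have e2 : -Complex.I * t = ((d : ℝ) : ℂ) * (Complex.I / τ) := by
    rw [ht, Complex.ofReal_natCast]; ring
  -- A positive real factor does not change the argument, so the principal square root is
  -- multiplicative here.
  have e3 : (-Complex.I * t) ^ (1 / 2 : ℂ) =
      (((d : ℝ) ^ (1 / 2 : ℝ) : ℝ) : ℂ) * (Complex.I / τ) ^ (1 / 2 : ℂ) := by
    have hI : Complex.I / τ ≠ 0 := div_ne_zero Complex.I_ne_zero hτ0
    have hd1 : ((d : ℝ) : ℂ) ≠ 0 := by simpa using hd0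
    rw [e2, Complex.ofReal_cpow hdr.le, Complex.cpow_def_of_ne_zero (mul_ne_zero hd1 hI),
      Complex.log_ofReal_mul hdr hI, Complex.cpow_def_of_ne_zero hd1,
      Complex.cpow_def_of_ne_zero hI, ← Complex.exp_add, Complex.ofReal_log hdr.le]
    congr 1
    push_cast
    ring
  rw [e1, e3, show -Real.pi * Complex.I * (x * t) ^ 2 / t
    = -(Real.pi * Complex.I * x ^ 2 * t) by field_simp, Complex.exp_neg]
  have := Complex.exp_ne_zero (Real.pi * Complex.I * x ^ 2 * t)
  field_simp

/-- Each fibre of `f` is stable under `π`, and the fixed points of a permutation of p-power order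
are congruent in number to the whole set modulo p. Only the fibre over `f x₀` contains a fixed
point. Working fibre by fibre leaves `M` an arbitrary abelian group, so the lemma serves integers,
subrings of ℂ and the module of theta series alike. -/
theorem sum_eq_add_nsmul_of_perm {X M : Type*} [Fintype X] [AddCommGroup M] {p m : ℕ}
    (hp : p.Prime) (π : Equiv.Perm X) (hπ : π ^ p ^ m = 1) (x₀ : X)
    (h0 : ∀ x, π x = x ↔ x = x₀) (f : X → M) (hf : ∀ x, f (π x) = f x) :
    ∃ w : M, ∑ x, f x = f x₀ + p • w := by
  classical
  have := Fact.mk hp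
  have key : ∀ v : M, ∃ j : ℕ, Fintype.card {x // f x = v} = (if v = f x₀ then 1 else 0) + p * j := by
    intro v
    let τ : Equiv.Perm {x // f x = v} := π.subtypePerm fun x => by rw [hf]
    have hτ : τ ^ p ^ m = 1 := by
      ext x
      simp [τ, Equiv.Perm.subtypePerm_pow, hπ]
    have h1 := Equiv.Perm.card_compl_support_modEq hτ
    have h2 : τ.supportᶜ.card = if v = f x₀ then 1 else 0 := by
      have h3 : ∀ x : {x // f x = v}, x ∈ τ.supportᶜ ↔ (x : X) = x₀ := fun x => by
        rw [Finset.mem_compl, Equiv.Perm.notMem_support, ← h0, Subtype.ext_iff]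
        rfl
      split_ifs with hv
      · rw [Finset.card_eq_one]
        refine ⟨⟨x₀, hv.symm⟩, ?_⟩
        ext x
        rw [h3, Finset.mem_singleton, Subtype.ext_iff]
      · rw [Finset.card_eq_zero, Finset.eq_empty_iff_forall_notMem]
        intro x hx
        exact hv (by rw [← x.2, (h3 x).1 hx])
    have h4 : τ.supportᶜ.card ≤ Fintype.card {x // f x = v} := Finset.card_le_univ _
    obtain ⟨j, hj⟩ := (Nat.modEq_iff_dvd' h4).1 h1
    exact ⟨j, by rw [← h2]; omega⟩
  choose j hj using key
  refine ⟨∑ v ∈ Finset.univ.image f, j v • v, ?_⟩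
  rw [Finset.sum_comp (fun v => v) f, Finset.smul_sum]
  have : ∀ v ∈ Finset.univ.image f, (Finset.univ.filter fun x => f x = v).card • v =
      (if v = f x₀ then v else 0) + p • j v • v := by
    intro v _
    rw [← Fintype.card_subtype, hj, add_smul, mul_smul]
    split_ifs <;> simp
  rw [Finset.sum_congr rfl this, Finset.sum_add_distrib, Finset.sum_ite_eq']
  simp

/-- Modulo 2 the terms at (i, j) and (j, i) cancel, and the diagonal terms vanish. -/
theorem even_dotProduct_mulVec {n : ℕ} (M : Matrix (Fin n) (Fin n) ℤ)
    (hs : ∀ i j, M i j = M j i) (hM : ∀ i, Even (M i i)) (x : Fin n → ℤ) :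
    Even (∑ i, ∑ j, x i * M i j * x j) := by
  rw [← ZMod.intCast_eq_zero_iff_even]
  push_cast
  rw [← Fintype.sum_prod_type']
  refine Finset.sum_involution (fun p _ => p.swap) ?_ ?_ ?_ ?_
  · rintro ⟨i, j⟩ -
    simp only [Prod.fst_swap, Prod.snd_swap]
    rw [hs j i, show (x j : ZMod 2) * M i j * x i = x i * M i j * x j by ring, CharTwo.add_self_eq_zero]
  · rintro ⟨i, j⟩ - h e
    obtain rfl : j = i := congrArg Prod.fst e
    exact h (by simp [ZMod.intCast_eq_zero_iff_even.2 (hM j)])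
  · simp
  · simp

/-- Otherwise 2/p would be a rational algebraic integer, hence an integer. -/
theorem not_two_eq_prime_mul_isIntegral {p : ℕ} (hp : p.Prime) (hp3 : 3 ≤ p) {a : ℂ}
    (ha : IsIntegral ℤ a) : (2 : ℂ) ≠ p * a := by
  intro h
  have hp0 : (p : ℂ) ≠ 0 := by exact_mod_cast hp.ne_zero
  have h1 : a = algebraMap ℚ ℂ (2 / p) := by
    rw [map_div₀, map_natCast, eq_div_iff hp0, mul_comm, ← h]; simp
  rw [h1, isIntegral_algebraMap_iff (algebraMap ℚ ℂ).injective,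
    IsIntegrallyClosed.isIntegral_iff] at ha
  obtain ⟨y, hy⟩ := ha
  have hp0' : (p : ℚ) ≠ 0 := by exact_mod_cast hp.ne_zero
  rw [eq_div_iff hp0'] at hy
  have h2 : y * p = 2 := by
    simp only [eq_intCast] at hy
    exact_mod_cast hy
  have h3 : (p : ℤ) ∣ 2 := ⟨y, by rw [← h2, mul_comm]⟩
  have := Int.le_of_dvd (by norm_num) h3
  omega

/-! ### The rational quadratic space, orthogonal vectors, and the level -/

namespace EvenLattice

variable {L : Type*} [AddCommGroup L] [Module.Free ℤ L] [Module.Finite ℤ L] (Λ : EvenLattice L)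

theorem exists_nsmul_eq_tmul (x : ℚ ⊗[ℤ] L) :
    ∃ N : ℕ, 0 < N ∧ ∃ v : L, (N : ℚ) • x = (1 : ℚ) ⊗ₜ[ℤ] v := by
  induction x with
  | zero => exact ⟨1, one_pos, 0, by simp⟩
  | tmul a v =>
    refine ⟨a.den, a.pos, a.num • v, ?_⟩
    rw [TensorProduct.smul_tmul', smul_eq_mul, Rat.den_mul_eq_num, TensorProduct.tmul_smul,
      TensorProduct.smul_tmul', zsmul_eq_mul, mul_one]
  | add x y hx hy =>
    obtain ⟨N, hN, v, hv⟩ := hx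
    obtain ⟨N', hN', v', hv'⟩ := hy
    refine ⟨N * N', Nat.mul_pos hN hN', N' • v + N • v', ?_⟩
    rw [TensorProduct.tmul_add, TensorProduct.tmul_smul, TensorProduct.tmul_smul, ← hv, ← hv',
      smul_add]
    simp only [← Nat.cast_smul_eq_nsmul ℚ, smul_smul, Nat.cast_mul]
    rw [mul_comm (N : ℚ)]

theorem formQ_self_pos {x : ℚ ⊗[ℤ] L} (hx : x ≠ 0) : 0 < Λ.formQ x x := by
  obtain ⟨N, hN, v, hv⟩ := exists_nsmul_eq_tmul x
  have hN' : (0 : ℚ) < N := by exact_mod_cast hN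
  have hv0 : v ≠ 0 := by
    rintro rfl
    rw [TensorProduct.tmul_zero] at hv
    exact hx ((smul_eq_zero.1 hv).resolve_left hN'.ne')
  have h1 : (N : ℚ) * (N * Λ.formQ x x) = (Λ.form v v : ℚ) := by
    have := Λ.formQ_tmul 1 1 v v
    rw [← hv] at this
    simpa using this
  have h2 : (0 : ℚ) < Λ.form v v := by exact_mod_cast Λ.posDef v hv0
  rw [← h1, ← mul_assoc] at h2
  exact (mul_pos_iff_of_pos_left (mul_pos hN' hN')).1 h2

theorem formQ_self_nonneg (x : ℚ ⊗[ℤ] L) : 0 ≤ Λ.formQ x x := by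
  rcases eq_or_ne x 0 with rfl | hx
  · simp
  · exact (Λ.formQ_self_pos hx).le

theorem tmul_one_injective (Λ : EvenLattice L) :
    Function.Injective fun v : L => (1 : ℚ) ⊗ₜ[ℤ] v := by
  intro v w h
  by_contra hne
  have h1 := Λ.posDef (v - w) (sub_ne_zero.2 hne)
  have h2 : (1 : ℚ) ⊗ₜ[ℤ] (v - w) = 0 := by rw [TensorProduct.tmul_sub]; exact sub_eq_zero.2 h
  have h3 := Λ.formQ_tmul 1 1 (v - w) (v - w)
  rw [h2] at h3
  have h4 : (Λ.form (v - w) (v - w) : ℚ) = 0 := by simpa using h3.symm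
  exact h1.ne' (by exact_mod_cast h4)

/-- Diagonalize the form over ℚ and clear denominators. The resulting finite-index sublattice of `L`
splits Gaussian sums into one-dimensional ones. -/
theorem exists_orthogonal :
    ∃ u : Fin (Module.finrank ℤ L) → L, (∀ i j, i ≠ j → Λ.form (u i) (u j) = 0) ∧
      (∀ i, 0 < Λ.form (u i) (u i)) ∧ ∀ x : ℚ ⊗[ℤ] L,
        x = ∑ i, (Λ.formQ x ((1 : ℚ) ⊗ₜ[ℤ] u i) / (Λ.form (u i) (u i) : ℚ)) •
          ((1 : ℚ) ⊗ₜ[ℤ] u i) := by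
  have hsymm : LinearMap.IsSymm Λ.formQ := ⟨fun x y => Λ.formQ_symm x y⟩
  obtain ⟨v', hv'⟩ := LinearMap.BilinForm.exists_orthogonal_basis hsymm
  have hrank : Module.finrank ℚ (ℚ ⊗[ℤ] L) = Module.finrank ℤ L := Module.finrank_baseChange
  let v := v'.reindex (finCongr hrank)
  have hv : ∀ i j, i ≠ j → Λ.formQ (v i) (v j) = 0 := by
    intro i j hij
    simp only [v, Module.Basis.reindex_apply]
    exact hv' fun h => hij ((finCongr hrank).symm.injective h)
  choose N hN u hu using fun i => exists_nsmul_eq_tmul (v i)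
  have hN0 : ∀ i, (N i : ℚ) ≠ 0 := fun i => by exact_mod_cast (hN i).ne'
  have hform : ∀ i j, (Λ.form (u i) (u j) : ℚ) = N i * N j * Λ.formQ (v i) (v j) := by
    intro i j
    have := Λ.formQ_tmul 1 1 (u i) (u j)
    rw [← hu, ← hu] at this
    simp only [map_smul, LinearMap.smul_apply, smul_eq_mul, one_mul] at this
    rw [← this]; ring
  have hpos : ∀ i, 0 < Λ.formQ (v i) (v i) := fun i => Λ.formQ_self_pos (v.ne_zero i)
  refine ⟨u, fun i j hij => ?_, fun i => ?_, fun x => ?_⟩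
  · have := hform i j
    rw [hv i j hij, mul_zero] at this
    exact_mod_cast this
  · have : (0 : ℚ) < Λ.form (u i) (u i) := by
      rw [hform]
      have := hpos i
      have : (0 : ℚ) < N i := by exact_mod_cast hN i
      positivity
    exact_mod_cast this
  · have hrepr : ∀ j, Λ.formQ x (v j) = v.repr x j * Λ.formQ (v j) (v j) := by
      intro j
      conv_lhs => rw [← v.sum_repr x]
      rw [map_sum, LinearMap.sum_apply, Finset.sum_eq_single j]
      · simp
      · intro i _ hij
        simp [hv i j hij]
      · simp
    conv_lhs => rw [← v.sum_repr x]
    refine Finset.sum_congr rfl fun i _ => ?_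
    rw [← hu, map_smul, smul_smul, hform, hrepr, smul_eq_mul]
    congr 1
    have := (hpos i).ne'
    have := hN0 i
    field_simp

theorem gram_symm (i j) : Λ.gram i j = Λ.gram j i := by
  simp only [gram, Matrix.of_apply]
  rw [Λ.symm]

theorem formQ_basis (c : Fin (Module.finrank ℤ L) → ℚ) (j) :
    Λ.formQ (∑ i, c i • ((1 : ℚ) ⊗ₜ[ℤ] Module.finBasis ℤ L i))
      ((1 : ℚ) ⊗ₜ[ℤ] Module.finBasis ℤ L j) = (Λ.gram.mulVec c) j := by
  rw [map_sum, LinearMap.sum_apply, Matrix.mulVec, dotProduct]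
  refine Finset.sum_congr rfl fun i _ => ?_
  rw [map_smul, LinearMap.smul_apply, formQ_tmul, smul_eq_mul, Λ.gram_symm]
  simp [gram, mul_comm]

theorem eq_sum_finBasis (x : ℚ ⊗[ℤ] L) :
    ∃ c : Fin (Module.finrank ℤ L) → ℚ,
      x = ∑ i, c i • ((1 : ℚ) ⊗ₜ[ℤ] Module.finBasis ℤ L i) := by
  refine ⟨((Module.finBasis ℤ L).baseChange ℚ).repr x, ?_⟩
  conv_lhs => rw [← ((Module.finBasis ℤ L).baseChange ℚ).sum_repr x]
  simp

theorem gram_det_ne_zero : Λ.gram.det ≠ 0 := by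
  intro h
  obtain ⟨c, hc, hG⟩ := Matrix.exists_mulVec_eq_zero_iff.2 h
  set x := ∑ i, c i • ((1 : ℚ) ⊗ₜ[ℤ] Module.finBasis ℤ L i) with hx
  have hx0 : x ≠ 0 := by
    intro h0
    apply hc
    have := Fintype.linearIndependent_iff.1 ((Module.finBasis ℤ L).baseChange ℚ).linearIndependent c
      (by simpa [hx] using h0)
    exact funext this
  have h1 : Λ.formQ x x = 0 := by
    conv_lhs => rw [hx]
    rw [map_sum (Λ.formQ _)]
    refine Finset.sum_eq_zero fun i _ => ?_
    rw [map_smul, formQ_basis, hG]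
    simp
  exact (Λ.formQ_self_pos hx0).ne' h1

theorem level_spec : 0 < Λ.level ∧
    ∃ M : Matrix (Fin (Module.finrank ℤ L)) (Fin (Module.finrank ℤ L)) ℤ,
      (Λ.level : ℚ) • Λ.gram⁻¹ = M.map (fun m : ℤ => (m : ℚ)) ∧ ∀ i, Even (M i i) := by
  refine Nat.sInf_mem (s := {l : ℕ | 0 < l ∧
    ∃ M : Matrix (Fin (Module.finrank ℤ L)) (Fin (Module.finrank ℤ L)) ℤ,
      (l : ℚ) • Λ.gram⁻¹ = M.map (fun m : ℤ => (m : ℚ)) ∧ ∀ i, Even (M i i)}) ?_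
  let G : Matrix (Fin (Module.finrank ℤ L)) (Fin (Module.finrank ℤ L)) ℤ :=
    Matrix.of fun i j => Λ.form (Module.finBasis ℤ L i) (Module.finBasis ℤ L j)
  have hG : Λ.gram = G.map (Int.castRingHom ℚ) := by ext i j; simp [gram, G]
  have hdet : Λ.gram.det = (G.det : ℚ) := by
    rw [hG]
    exact ((Int.castRingHom ℚ).map_det G).symm
  have hadj : Λ.gram.adjugate = G.adjugate.map (Int.castRingHom ℚ) := by
    rw [hG]
    exact ((Int.castRingHom ℚ).map_adjugate G).symm
  have h0 : (G.det : ℚ) ≠ 0 := hdet ▸ Λ.gram_det_ne_zero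
  have h0' : G.det ≠ 0 := by exact_mod_cast h0
  -- The adjugate makes |det G| · G⁻¹ integral, and the factor 2 makes the diagonal even. So the set
  -- defining the level is nonempty, and its infimum is not the default value 0.
  refine ⟨2 * G.det.natAbs, by have := Int.natAbs_pos.2 h0'; positivity,
    (2 * G.det.sign) • G.adjugate, ?_, fun i => ?_⟩
  · rw [Matrix.inv_def, hdet, hadj, Ring.inverse_eq_inv', smul_smul]
    ext i j
    simp only [Matrix.smul_apply, Matrix.map_apply, smul_eq_mul, eq_intCast]
    have h2 : ((G.det.natAbs : ℕ) : ℚ) = (G.det.sign : ℚ) * G.det := by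
      rw [Nat.cast_natAbs, ← Int.sign_mul_self_eq_abs]; push_cast; rfl
    rw [Nat.cast_mul, h2, Int.cast_mul]
    field_simp
    push_cast
    ring
  · rw [Matrix.smul_apply, smul_eq_mul, mul_assoc]
    exact even_two_mul _

/-- In terms of the values `b(y, eᵢ)` on a basis, a dual vector times the level lies in `L`. -/
theorem exists_level_matrix :
    ∃ M : Matrix (Fin (Module.finrank ℤ L)) (Fin (Module.finrank ℤ L)) ℤ,
      (∀ i j, M i j = M j i) ∧ (∀ i, Even (M i i)) ∧
      ∀ (y : ℚ ⊗[ℤ] L) (m : Fin (Module.finrank ℤ L) → ℤ),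
        (∀ j, Λ.formQ y ((1 : ℚ) ⊗ₜ[ℤ] Module.finBasis ℤ L j) = m j) →
        (Λ.level : ℚ) • y = (1 : ℚ) ⊗ₜ[ℤ] (∑ i, (∑ j, M i j * m j) • Module.finBasis ℤ L i) ∧
        (Λ.level : ℚ) * Λ.formQ y y = ((∑ i, ∑ j, m i * M i j * m j : ℤ) : ℚ) := by
  obtain ⟨hs, M, hM, hev⟩ := Λ.level_spec
  have hdet : IsUnit Λ.gram.det := Λ.gram_det_ne_zero.isUnit
  have hMap : ∀ i j, (M i j : ℚ) = (Λ.level : ℚ) * Λ.gram⁻¹ i j := fun i j =>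
    (congrFun (congrFun hM i) j).symm
  have hsymm : Λ.gram.transpose = Λ.gram := by ext i j; exact Λ.gram_symm j i
  refine ⟨M, fun i j => ?_, hev, fun y m hm => ?_⟩
  · have h1 : Λ.gram⁻¹ i j = Λ.gram⁻¹ j i := by
      conv_lhs => rw [← hsymm, ← Matrix.transpose_nonsing_inv]
      rfl
    have : (M i j : ℚ) = M j i := by rw [hMap, hMap, h1]
    exact_mod_cast this
  · obtain ⟨c, hc⟩ := eq_sum_finBasis y
    have hGc : Λ.gram.mulVec c = fun j => (m j : ℚ) := by
      ext j
      rw [← formQ_basis, ← hc, hm]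
    have hcm : ∀ i, (Λ.level : ℚ) * c i = ((∑ j, M i j * m j : ℤ) : ℚ) := by
      intro i
      have : c = Λ.gram⁻¹.mulVec fun j => (m j : ℚ) := by
        rw [← hGc, Matrix.mulVec_mulVec, Matrix.nonsing_inv_mul _ hdet, Matrix.one_mulVec]
      rw [this, Matrix.mulVec, dotProduct, Finset.mul_sum]
      push_cast
      refine Finset.sum_congr rfl fun j _ => ?_
      rw [hMap, mul_assoc]
    have h1 : (Λ.level : ℚ) • y =
        (1 : ℚ) ⊗ₜ[ℤ] (∑ i, (∑ j, M i j * m j) • Module.finBasis ℤ L i) := by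
      rw [hc, Finset.smul_sum, TensorProduct.tmul_sum]
      refine Finset.sum_congr rfl fun i _ => ?_
      rw [smul_smul, hcm, TensorProduct.tmul_smul, Int.cast_smul_eq_zsmul]
    refine ⟨h1, ?_⟩
    rw [← smul_eq_mul, ← map_smul, h1, TensorProduct.tmul_sum, map_sum]
    push_cast
    refine Finset.sum_congr rfl fun i _ => ?_
    rw [TensorProduct.tmul_smul, ← Int.cast_smul_eq_zsmul ℚ, map_smul, hm, smul_eq_mul,
      Int.cast_sum, Finset.sum_mul]
    refine Finset.sum_congr rfl fun j _ => ?_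
    push_cast
    ring

theorem exists_level_mul_formQ (y : Λ.dual) :
    ∃ m : ℤ, (Λ.level : ℚ) * (Λ.formQ y y / 2) = m := by
  obtain ⟨M, hs, hev, h⟩ := Λ.exists_level_matrix
  choose m hm using y.2
  obtain ⟨r, hr⟩ := even_dotProduct_mulVec M hs hev fun i => m (Module.finBasis ℤ L i)
  refine ⟨r, ?_⟩
  have := (h y (fun i => m (Module.finBasis ℤ L i)) fun j => hm _).2
  rw [hr] at this
  rw [← mul_div_assoc, this]
  push_cast
  ring

instance finite_det : Finite Λ.Det := by
  obtain ⟨M, hs, hev, h⟩ := Λ.exists_level_matrix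
  obtain ⟨hpos, -⟩ := Λ.level_spec
  have : NeZero Λ.level := ⟨hpos.ne'⟩
  have hl : (Λ.level : ℚ) ≠ 0 := by exact_mod_cast hpos.ne'
  choose m hm using fun y : Λ.dual => y.2
  -- A class is determined by the pairings of a representative with the basis modulo the level s: if
  -- y pairs with the basis in sℤ, then y = s · (y/s), and s times the dual vector y/s lies in L.
  refine Finite.of_injective (fun (ρ : Λ.Det) (j : Fin (Module.finrank ℤ L)) =>
    ((m ρ.out (Module.finBasis ℤ L j) : ℤ) : ZMod Λ.level)) fun ρ ρ' hρ => ?_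
  rw [← QuotientAddGroup.out_eq' ρ, ← QuotientAddGroup.out_eq' ρ', QuotientAddGroup.eq]
  have hdvd : ∀ j, ∃ t : ℤ, m ρ'.out (Module.finBasis ℤ L j) - m ρ.out (Module.finBasis ℤ L j)
      = Λ.level * t := fun j => (ZMod.intCast_eq_intCast_iff_dvd_sub _ _ _).1 (congrFun hρ j)
  choose t ht using hdvd
  have h1 := (h (-(ρ.out : ℚ ⊗[ℤ] L) + (ρ'.out : ℚ ⊗[ℤ] L)) (fun j => Λ.level * t j) fun j => by
    rw [← ht, map_add, map_neg, LinearMap.add_apply, LinearMap.neg_apply, hm, hm]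
    push_cast
    ring).1
  refine ⟨∑ i, (∑ j, M i j * t j) • Module.finBasis ℤ L i, ?_⟩
  have h2 : ∑ i, (∑ j, M i j * (Λ.level * t j)) • Module.finBasis ℤ L i =
      (Λ.level : ℤ) • ∑ i, (∑ j, M i j * t j) • Module.finBasis ℤ L i := by
    rw [Finset.smul_sum]
    refine Finset.sum_congr rfl fun i _ => ?_
    rw [smul_smul, Finset.mul_sum]
    congr 1
    exact Finset.sum_congr rfl fun j _ => by ring
  rw [h2, TensorProduct.tmul_smul, ← Int.cast_smul_eq_zsmul ℚ, Int.cast_natCast] at h1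
  exact (smul_right_injective _ hl h1).symm

end EvenLattice

/-! ### The discriminant form, its pairing, and the action of automorphisms -/

noncomputable section

namespace EvenLattice

theorem expChar_coe (t : ℚ) :
    expChar (t : AddCircle (1 : ℚ)) = Complex.exp (2 * Real.pi * Complex.I * (t : ℂ)) :=
  rfl

theorem expChar_add (s t : AddCircle (1 : ℚ)) : expChar (s + t) = expChar s * expChar t := by
  induction s using QuotientAddGroup.induction_on with | _ s
  induction t using QuotientAddGroup.induction_on with | _ t
  rw [← AddCircle.coe_add]
  simp only [expChar_coe]
  rw [← Complex.exp_add]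
  push_cast
  ring_nf

theorem expChar_zero : expChar 0 = 1 := by
  rw [← QuotientAddGroup.mk_zero, expChar_coe]
  simp

theorem expChar_neg (t : AddCircle (1 : ℚ)) : expChar (-t) = (expChar t)⁻¹ := by
  refine eq_inv_of_mul_eq_one_left ?_
  rw [← expChar_add, neg_add_cancel, expChar_zero]

variable {L : Type*} [AddCommGroup L] [Module.Free ℤ L] [Module.Finite ℤ L] (Λ : EvenLattice L)

theorem discForm_mk (x : Λ.dual) :
    Λ.discForm (x : Λ.Det) = ((Λ.formQ x x / 2 : ℚ) : AddCircle (1 : ℚ)) := rfl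

theorem discForm_zero : Λ.discForm 0 = 0 := by
  have := Λ.discForm_mk 0
  rw [QuotientAddGroup.mk_zero] at this
  rw [this]
  simp

/-- The character `e(b(ρ, μ))` on pairs of elements of `Det(L)`. -/
def pairing (ρ μ : Λ.Det) : ℂ :=
  expChar (Λ.discForm (ρ + μ) - Λ.discForm ρ - Λ.discForm μ)

theorem pairing_mk (x y : Λ.dual) :
    Λ.pairing x y = Complex.exp (2 * Real.pi * Complex.I * (Λ.formQ x y : ℂ)) := by
  rw [pairing, ← QuotientAddGroup.mk_add, discForm_mk, discForm_mk, discForm_mk,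
    ← AddCircle.coe_sub, ← AddCircle.coe_sub, expChar_coe]
  congr 3
  rw [AddSubgroup.coe_add, map_add, map_add, LinearMap.add_apply, LinearMap.add_apply,
    Λ.formQ_symm y x]
  ring

theorem pairing_zero_left (μ : Λ.Det) : Λ.pairing 0 μ = 1 := by
  rw [pairing, zero_add, discForm_zero, sub_zero, sub_self, expChar_zero]

theorem pairing_zero_right (μ : Λ.Det) : Λ.pairing μ 0 = 1 := by
  rw [pairing, add_zero, discForm_zero, sub_zero, sub_self, expChar_zero]

theorem level_root_pow :
    Complex.exp (2 * Real.pi * Complex.I / (Λ.level : ℂ)) ^ Λ.level = 1 := by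
  have h0 : (Λ.level : ℂ) ≠ 0 := by exact_mod_cast Λ.level_spec.1.ne'
  rw [← Complex.exp_nat_mul, mul_div_cancel₀ _ h0, Complex.exp_two_pi_mul_I]

/-- The level clears the denominators of q. The exponent is reduced to a natural number because O_L
is generated by the root of unity itself, and to make integrality immediate. -/
theorem expChar_discForm_eq (ρ : Λ.Det) : ∃ m : ℕ, expChar (Λ.discForm ρ) =
    Complex.exp (2 * Real.pi * Complex.I / (Λ.level : ℂ)) ^ m := by
  induction ρ using QuotientAddGroup.induction_on with | _ y
  obtain ⟨m, hm⟩ := Λ.exists_level_mul_formQ y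
  have h0 : (Λ.level : ℂ) ≠ 0 := by exact_mod_cast Λ.level_spec.1.ne'
  have h0' : (Λ.level : ℤ) ≠ 0 := by exact_mod_cast Λ.level_spec.1.ne'
  refine ⟨(m % Λ.level).toNat, ?_⟩
  rw [← zpow_natCast, Int.toNat_of_nonneg (Int.emod_nonneg _ h0')]
  have hz : Complex.exp (2 * Real.pi * Complex.I / (Λ.level : ℂ)) ≠ 0 := Complex.exp_ne_zero _
  have h1 : Complex.exp (2 * Real.pi * Complex.I / (Λ.level : ℂ)) ^ (m % (Λ.level : ℤ)) =
      Complex.exp (2 * Real.pi * Complex.I / (Λ.level : ℂ)) ^ m := by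
    conv_rhs => rw [← Int.emod_add_mul_ediv m Λ.level]
    rw [zpow_add₀ hz, zpow_mul, zpow_natCast, level_root_pow, one_zpow, mul_one]
  rw [h1, discForm_mk, expChar_coe, ← Complex.exp_int_mul]
  congr 1
  have h2 : (Λ.level : ℂ) * ((Λ.formQ y y / 2 : ℚ) : ℂ) = m := by exact_mod_cast hm
  rw [← h2]
  field_simp

theorem level_root_mem :
    Complex.exp (2 * Real.pi * Complex.I / (Λ.level : ℂ)) ∈ Λ.coeffRing :=
  Algebra.subset_adjoin (by simp)

theorem gaussSum_inv_mem : Λ.gaussSum⁻¹ ∈ Λ.coeffRing :=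
  Algebra.subset_adjoin (by simp)

theorem expChar_discForm_mem (ρ : Λ.Det) : expChar (Λ.discForm ρ) ∈ Λ.coeffRing := by
  obtain ⟨m, hm⟩ := Λ.expChar_discForm_eq ρ
  rw [hm]
  exact pow_mem Λ.level_root_mem _

theorem expChar_discForm_inv_mem (ρ : Λ.Det) : (expChar (Λ.discForm ρ))⁻¹ ∈ Λ.coeffRing := by
  obtain ⟨m, hm⟩ := Λ.expChar_discForm_eq ρ
  have h : (expChar (Λ.discForm ρ))⁻¹ = (expChar (Λ.discForm ρ)) ^ (Λ.level - 1) := by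
    refine inv_eq_of_mul_eq_one_right ?_
    rw [← pow_succ', Nat.sub_add_cancel Λ.level_spec.1, hm, pow_right_comm, level_root_pow, one_pow]
  rw [h]
  exact pow_mem (Λ.expChar_discForm_mem ρ) _

theorem pairing_mem (ρ μ : Λ.Det) : Λ.pairing ρ μ ∈ Λ.coeffRing := by
  rw [pairing, sub_eq_add_neg, sub_eq_add_neg, expChar_add, expChar_add, expChar_neg, expChar_neg]
  exact mul_mem (mul_mem (Λ.expChar_discForm_mem _) (Λ.expChar_discForm_inv_mem _))
    (Λ.expChar_discForm_inv_mem _)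

theorem isIntegral_expChar_discForm (ρ : Λ.Det) : IsIntegral ℤ (expChar (Λ.discForm ρ)) := by
  obtain ⟨m, hm⟩ := Λ.expChar_discForm_eq ρ
  rw [hm]
  refine IsIntegral.pow ⟨Polynomial.X ^ Λ.level - 1,
    Polynomial.monic_X_pow_sub_C 1 Λ.level_spec.1.ne', ?_⟩ _
  rw [Polynomial.eval₂_sub, Polynomial.eval₂_pow, Polynomial.eval₂_X, Polynomial.eval₂_one,
    level_root_pow, sub_self]

variable {Λ}

theorem autDet_mk (σ : Λ.autGroup) (y : Λ.dual) :
    autDet σ (y : Λ.Det) = ((autDual σ y : Λ.dual) : Λ.Det) := rfl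

theorem formQ_autQ_autQ (σ : Λ.autGroup) (x y : ℚ ⊗[ℤ] L) :
    Λ.formQ (autQ σ x) (autQ σ y) = Λ.formQ x y := by
  induction y with
  | zero => simp
  | add a b ha hb => simp only [map_add, ha, hb]
  | tmul a v =>
    have h : a ⊗ₜ[ℤ] v = a • ((1 : ℚ) ⊗ₜ[ℤ] v) := by
      rw [TensorProduct.smul_tmul', smul_eq_mul, mul_one]
    rw [h, map_smul, map_smul, map_smul, autQ_tmul, formQ_autQ]

theorem discForm_autDet (σ : Λ.autGroup) (ρ : Λ.Det) :
    Λ.discForm (autDet σ ρ) = Λ.discForm ρ := by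
  induction ρ using QuotientAddGroup.induction_on with | _ y
  rw [autDet_mk, discForm_mk, discForm_mk]
  congr 2
  exact formQ_autQ_autQ σ y y

theorem pairing_autDet (σ : Λ.autGroup) (ρ μ : Λ.Det) :
    Λ.pairing (autDet σ ρ) (autDet σ μ) = Λ.pairing ρ μ := by
  rw [pairing, ← map_add, discForm_autDet, discForm_autDet, discForm_autDet, pairing]

theorem autDet_one (ρ : Λ.Det) : autDet (1 : Λ.autGroup) ρ = ρ := by
  induction ρ using QuotientAddGroup.induction_on with | _ y
  rw [autDet_mk]
  congr 1
  refine Subtype.ext ?_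
  change autQ (1 : Λ.autGroup) (y : ℚ ⊗[ℤ] L) = y
  generalize (y : ℚ ⊗[ℤ] L) = x
  induction x with
  | zero => simp
  | add a b ha hb => rw [map_add, ha, hb]
  | tmul a v => rfl

theorem autQ_mul (σ τ : Λ.autGroup) (x : ℚ ⊗[ℤ] L) : autQ (σ * τ) x = autQ σ (autQ τ x) := by
  induction x with
  | zero => simp
  | add a b ha hb => simp only [map_add, ha, hb]
  | tmul a v => rfl

theorem autDet_mul (σ τ : Λ.autGroup) (ρ : Λ.Det) :
    autDet (σ * τ) ρ = autDet σ (autDet τ ρ) := by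
  induction ρ using QuotientAddGroup.induction_on with | _ y
  simp only [autDet_mk]
  congr 1
  exact Subtype.ext (autQ_mul σ τ y)

variable (Λ) in
/-- The action of the automorphism group on `Det(L)` by permutations. -/
def autPerm : Λ.autGroup →* Equiv.Perm Λ.Det where
  toFun σ :=
    { toFun := autDet σ
      invFun := autDet σ⁻¹
      left_inv := fun ρ => by rw [← autDet_mul, inv_mul_cancel, autDet_one]
      right_inv := fun ρ => by rw [← autDet_mul, mul_inv_cancel, autDet_one] }
  map_one' := Equiv.ext autDet_one
  map_mul' σ τ := Equiv.ext (autDet_mul σ τ)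

theorem autPerm_apply (σ : Λ.autGroup) (ρ : Λ.Det) : Λ.autPerm σ ρ = autDet σ ρ := rfl

theorem cosetTheta_autDet (σ : Λ.autGroup) (ρ : Λ.Det) :
    Λ.cosetTheta (autDet σ ρ) = Λ.cosetTheta ρ := by
  have hinv : ∀ (τ τ' : Λ.autGroup) (_ : τ * τ' = 1) (y : Λ.dual),
      autDual τ (autDual τ' y) = y := by
    intro τ τ' h y
    refine Subtype.ext ?_
    change autQ τ (autQ τ' (y : ℚ ⊗[ℤ] L)) = y
    rw [← autQ_mul, h]
    generalize (y : ℚ ⊗[ℤ] L) = x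
    induction x with
    | zero => simp
    | add a b ha hb => rw [map_add, ha, hb]
    | tmul a v => rfl
  funext z
  let e : {x : Λ.dual // (x : Λ.Det) = ρ} ≃ {x : Λ.dual // (x : Λ.Det) = autDet σ ρ} :=
    { toFun := fun x => ⟨autDual σ x.1, by rw [← autDet_mk, x.2]⟩
      invFun := fun x => ⟨autDual σ⁻¹ x.1, by
        rw [← autDet_mk, x.2, ← autDet_mul, inv_mul_cancel, autDet_one]⟩
      left_inv := fun x => Subtype.ext (hinv _ _ (inv_mul_cancel σ) x.1)
      right_inv := fun x => Subtype.ext (hinv _ _ (mul_inv_cancel σ) x.1) }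
  rw [cosetTheta, ← e.tsum_eq]
  refine tsum_congr fun x => ?_
  have : Λ.formQ ((e x).1 : ℚ ⊗[ℤ] L) ((e x).1 : ℚ ⊗[ℤ] L) = Λ.formQ x.1 x.1 :=
    formQ_autQ_autQ σ _ _
  rw [this]

theorem theta_eq_cosetTheta_zero : Λ.theta = Λ.cosetTheta 0 := by
  funext z
  let e : L ≃ {x : Λ.dual // (x : Λ.Det) = 0} := Equiv.ofBijective
    (fun v => ⟨⟨(1 : ℚ) ⊗ₜ[ℤ] v, fun x => ⟨Λ.form v x, by simp [formQ_tmul]⟩⟩,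
      (QuotientAddGroup.eq_zero_iff _).2 ⟨v, rfl⟩⟩) ⟨fun v w h => by
        exact Λ.tmul_one_injective (congrArg (fun x => ((x.1 : Λ.dual) : ℚ ⊗[ℤ] L)) h), by
        rintro ⟨y, hy⟩
        obtain ⟨v, hv⟩ := (QuotientAddGroup.eq_zero_iff _).1 hy
        exact ⟨v, Subtype.ext (Subtype.ext hv)⟩⟩
  rw [theta, cosetTheta, ← e.tsum_eq]
  refine tsum_congr fun v => ?_
  have : Λ.formQ ((e v).1 : ℚ ⊗[ℤ] L) ((e v).1 : ℚ ⊗[ℤ] L) = Λ.form v v := by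
    change Λ.formQ ((1 : ℚ) ⊗ₜ[ℤ] v) ((1 : ℚ) ⊗ₜ[ℤ] v) = _
    rw [formQ_tmul]; simp
  rw [this]
  norm_num

end EvenLattice

end

/-! ### Poisson summation over an orthogonal sublattice -/

noncomputable section

namespace EvenLattice

variable {L : Type*} [AddCommGroup L] [Module.Free ℤ L] [Module.Finite ℤ L] (Λ : EvenLattice L)

/-- The term `exp(πi b(y,y) z)` of a theta series. -/
def gaussTerm (y : ℚ ⊗[ℤ] L) (z : ℂ) : ℂ :=
  Complex.exp (2 * Real.pi * Complex.I * (((Λ.formQ y y : ℚ) : ℂ) / 2) * z)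

theorem cosetTheta_eq (ρ : Λ.Det) (z : ℍ) :
    Λ.cosetTheta ρ z =
      ∑' x : {x : Λ.dual // (x : Λ.Det) = ρ}, Λ.gaussTerm (x : Λ.dual) (z : ℂ) := rfl

theorem norm_gaussTerm (y : ℚ ⊗[ℤ] L) (z : ℂ) :
    ‖Λ.gaussTerm y z‖ = Real.exp (-(Real.pi * (Λ.formQ y y : ℝ) * z.im)) := by
  rw [gaussTerm, Complex.norm_exp]
  congr 1
  rw [show 2 * (Real.pi : ℂ) * Complex.I * (((Λ.formQ y y : ℚ) : ℂ) / 2) * z =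
    ((Real.pi * (Λ.formQ y y : ℝ) : ℝ) : ℂ) * (z * Complex.I) by push_cast; ring,
    Complex.re_ofReal_mul, Complex.mul_I_re]
  ring

/-- Pairwise orthogonal vectors in a lattice, as many as the rank. -/
structure OrthogonalFamily where
  vec : Fin (Module.finrank ℤ L) → L
  sq : Fin (Module.finrank ℤ L) → ℕ
  sq_pos : ∀ i, 0 < sq i
  form_self : ∀ i, Λ.form (vec i) (vec i) = sq i
  form_of_ne : ∀ i j, i ≠ j → Λ.form (vec i) (vec j) = 0
  expand : ∀ x : ℚ ⊗[ℤ] L, x = ∑ i, (Λ.formQ x ((1 : ℚ) ⊗ₜ[ℤ] vec i) / (sq i : ℚ)) •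
    ((1 : ℚ) ⊗ₜ[ℤ] vec i)

theorem nonempty_orthogonalFamily : Nonempty Λ.OrthogonalFamily := by
  obtain ⟨u, h1, h2, h3⟩ := Λ.exists_orthogonal
  have h4 : ∀ i, ((Λ.form (u i) (u i)).toNat : ℤ) = Λ.form (u i) (u i) := fun i =>
    Int.toNat_of_nonneg (h2 i).le
  refine ⟨⟨u, fun i => (Λ.form (u i) (u i)).toNat, fun i => ?_, fun i => (h4 i).symm, h1,
    fun x => ?_⟩⟩
  · have := h2 i
    simpa using this
  · have h5 : ∀ i, (((Λ.form (u i) (u i)).toNat : ℕ) : ℚ) = (Λ.form (u i) (u i) : ℚ) := fun i => by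
      exact_mod_cast h4 i
    simp only [h5]
    exact h3 x

namespace OrthogonalFamily

variable {Λ} (B : Λ.OrthogonalFamily)

/-- The vector with given rational coordinates. -/
def comb (c : Fin (Module.finrank ℤ L) → ℚ) : ℚ ⊗[ℤ] L :=
  ∑ i, c i • ((1 : ℚ) ⊗ₜ[ℤ] B.vec i)

/-- The coordinates of a vector. -/
def coord (x : ℚ ⊗[ℤ] L) (i : Fin (Module.finrank ℤ L)) : ℚ :=
  Λ.formQ x ((1 : ℚ) ⊗ₜ[ℤ] B.vec i) / (B.sq i : ℚ)

theorem comb_coord (x : ℚ ⊗[ℤ] L) : B.comb (B.coord x) = x := (B.expand x).symm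

theorem sq_ne_zero (i) : (B.sq i : ℚ) ≠ 0 := by exact_mod_cast (B.sq_pos i).ne'

theorem formQ_comb_vec (c : Fin (Module.finrank ℤ L) → ℚ) (j) :
    Λ.formQ (B.comb c) ((1 : ℚ) ⊗ₜ[ℤ] B.vec j) = c j * B.sq j := by
  rw [comb, map_sum, LinearMap.sum_apply, Finset.sum_eq_single j]
  · simp [formQ_tmul, B.form_self]
  · intro i _ hij
    simp [formQ_tmul, B.form_of_ne i j hij]
  · simp

theorem formQ_comb_comb (c c' : Fin (Module.finrank ℤ L) → ℚ) :
    Λ.formQ (B.comb c) (B.comb c') = ∑ i, c i * c' i * B.sq i := by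
  conv_lhs => rw [comb.eq_def B c', map_sum]
  refine Finset.sum_congr rfl fun i _ => ?_
  rw [map_smul, formQ_comb_vec, smul_eq_mul]
  ring

theorem comb_add (c c' : Fin (Module.finrank ℤ L) → ℚ) :
    B.comb (c + c') = B.comb c + B.comb c' := by
  simp [comb, add_smul, Finset.sum_add_distrib]

/-- Integral combinations, as elements of `L`. -/
def lift : (Fin (Module.finrank ℤ L) → ℤ) →+ L where
  toFun a := ∑ i, a i • B.vec i
  map_zero' := by simp
  map_add' a a' := by simp [add_smul, Finset.sum_add_distrib]

theorem tmul_lift (a : Fin (Module.finrank ℤ L) → ℤ) :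
    (1 : ℚ) ⊗ₜ[ℤ] B.lift a = B.comb fun i => (a i : ℚ) := by
  simp only [lift, comb, AddMonoidHom.coe_mk, ZeroHom.coe_mk, TensorProduct.tmul_sum]
  refine Finset.sum_congr rfl fun i _ => ?_
  rw [TensorProduct.tmul_smul, Int.cast_smul_eq_zsmul]

theorem coord_comb (c : Fin (Module.finrank ℤ L) → ℚ) : B.coord (B.comb c) = c := by
  ext i
  rw [coord, formQ_comb_vec, mul_div_assoc, div_self (B.sq_ne_zero i), mul_one]

theorem lift_injective : Function.Injective B.lift := by
  intro a a' h
  have h1 : B.comb (fun i => (a i : ℚ)) = B.comb fun i => (a' i : ℚ) := by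
    rw [← tmul_lift, ← tmul_lift, h]
  have h2 := congrArg B.coord h1
  rw [coord_comb, coord_comb] at h2
  ext i
  exact_mod_cast congrFun h2 i

/-- Vectors in the dual of the sublattice spanned by the family. -/
def dualComb (a : Fin (Module.finrank ℤ L) → ℤ) : ℚ ⊗[ℤ] L :=
  B.comb fun i => (a i : ℚ) / B.sq i

theorem formQ_dualComb_vec (a : Fin (Module.finrank ℤ L) → ℤ) (i) :
    Λ.formQ (B.dualComb a) ((1 : ℚ) ⊗ₜ[ℤ] B.vec i) = a i := by
  rw [dualComb, formQ_comb_vec, div_mul_cancel₀ _ (B.sq_ne_zero i)]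

theorem gaussTerm_dualComb (x : ℚ ⊗[ℤ] L) (a : Fin (Module.finrank ℤ L) → ℤ) (z : ℂ) :
    Complex.exp (2 * Real.pi * Complex.I * (Λ.formQ x (B.dualComb a) : ℂ)) *
        Λ.gaussTerm (B.dualComb a) z =
      ∏ i, Complex.exp (2 * Real.pi * Complex.I * (a i * ((B.coord x i : ℝ) : ℂ)) +
          Real.pi * Complex.I * ((a i : ℂ) ^ 2 / B.sq i) * z) := by
  have h1 : Λ.formQ x (B.dualComb a) = ∑ i, a i * B.coord x i := by
    conv_lhs => rw [← B.comb_coord x, dualComb, formQ_comb_comb]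
    refine Finset.sum_congr rfl fun i _ => ?_
    have := B.sq_ne_zero i
    field_simp
  have h2 : Λ.formQ (B.dualComb a) (B.dualComb a) = ∑ i, (a i : ℚ) ^ 2 / B.sq i := by
    rw [dualComb, formQ_comb_comb]
    refine Finset.sum_congr rfl fun i _ => ?_
    have := B.sq_ne_zero i
    field_simp
  rw [gaussTerm, ← Complex.exp_add, ← Complex.exp_sum, h1, h2]
  congr 1
  push_cast
  rw [Finset.sum_add_distrib, Finset.mul_sum, Finset.sum_div, Finset.mul_sum, Finset.sum_mul]
  congr 1
  refine Finset.sum_congr rfl fun i _ => ?_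
  ring

theorem gaussTerm_add_lift (x : ℚ ⊗[ℤ] L) (a : Fin (Module.finrank ℤ L) → ℤ) (z : ℂ) :
    Λ.gaussTerm (x + (1 : ℚ) ⊗ₜ[ℤ] B.lift a) z =
      ∏ i, Complex.exp (Real.pi * Complex.I * B.sq i * (((B.coord x i : ℝ) : ℂ) + a i) ^ 2 * z) := by
  have h1 : Λ.formQ (x + (1 : ℚ) ⊗ₜ[ℤ] B.lift a) (x + (1 : ℚ) ⊗ₜ[ℤ] B.lift a) =
      ∑ i, (B.coord x i + a i) ^ 2 * B.sq i := by
    conv_lhs => rw [← B.comb_coord x, tmul_lift, ← comb_add, formQ_comb_comb]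
    refine Finset.sum_congr rfl fun i _ => ?_
    simp only [Pi.add_apply]
    ring
  rw [gaussTerm, ← Complex.exp_sum, h1]
  congr 1
  push_cast
  rw [Finset.sum_div, Finset.mul_sum, Finset.sum_mul]
  refine Finset.sum_congr rfl fun i _ => ?_
  ring

/-- The constant `∏ √dᵢ`. -/
def vol : ℝ := ∏ i, (B.sq i : ℝ) ^ (1 / 2 : ℝ)

theorem vol_pos : 0 < B.vol :=
  Finset.prod_pos fun i _ => Real.rpow_pos_of_pos (by exact_mod_cast B.sq_pos i) _

theorem summable_dualComb (x : ℚ ⊗[ℤ] L) {z : ℂ} (hz : 0 < z.im) :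
    Summable fun a : Fin (Module.finrank ℤ L) → ℤ =>
      Complex.exp (2 * Real.pi * Complex.I * (Λ.formQ x (B.dualComb a) : ℂ)) *
        Λ.gaussTerm (B.dualComb a) z := by
  simp_rw [gaussTerm_dualComb]
  exact (hasSum_prod_apply_fin (fun i (m : ℤ) =>
    Complex.exp (2 * Real.pi * Complex.I * (m * ((B.coord x i : ℝ) : ℂ)) +
      Real.pi * Complex.I * ((m : ℂ) ^ 2 / B.sq i) * z))
      fun i => (tsum_exp_sq_translate (B.sq_pos i) _ hz).2.1).summable

/-- Poisson summation for the sublattice spanned by the family. -/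
theorem tsum_gaussTerm_add_lift (x : ℚ ⊗[ℤ] L) {z : ℂ} (hz : 0 < z.im) :
    ∑' a, Λ.gaussTerm (x + (1 : ℚ) ⊗ₜ[ℤ] B.lift a) (-z⁻¹) =
      (B.vol : ℂ)⁻¹ * (((Complex.I / z) ^ (1 / 2 : ℂ))⁻¹) ^ Module.finrank ℤ L *
        ∑' a, Complex.exp (2 * Real.pi * Complex.I * (Λ.formQ x (B.dualComb a) : ℂ)) *
          Λ.gaussTerm (B.dualComb a) z := by
  have h := fun i => tsum_exp_sq_translate (B.sq_pos i) (B.coord x i) hz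
  simp_rw [gaussTerm_dualComb, gaussTerm_add_lift]
  rw [(hasSum_prod_apply_fin _ fun i => (h i).1).tsum_eq,
    (hasSum_prod_apply_fin _ fun i => (h i).2.1).tsum_eq, Finset.prod_congr rfl fun i _ => (h i).2.2,
    Finset.prod_mul_distrib, Finset.prod_mul_distrib, Finset.prod_const, Finset.card_univ,
    Fintype.card_fin, vol, Complex.ofReal_prod, Finset.prod_inv_distrib]

end OrthogonalFamily

end EvenLattice

end

/-! ### Theta inversion and the limit at i∞ -/

noncomputable section

namespace EvenLattice

variable {L : Type*} [AddCommGroup L] [Module.Free ℤ L] [Module.Finite ℤ L] (Λ : EvenLattice L)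

instance fintypeDet : Fintype Λ.Det := Fintype.ofFinite _

/-- The embedding of `L` in its dual. -/
def toDual : L →+ Λ.dual where
  toFun v := ⟨(1 : ℚ) ⊗ₜ[ℤ] v, fun x => ⟨Λ.form v x, by simp [formQ_tmul]⟩⟩
  map_zero' := Subtype.ext (TensorProduct.tmul_zero _ _)
  map_add' v w := Subtype.ext (TensorProduct.tmul_add _ _ _)

theorem toDual_mk (v : L) : ((Λ.toDual v : Λ.dual) : Λ.Det) = 0 :=
  (QuotientAddGroup.eq_zero_iff _).2 ⟨v, rfl⟩

/-- A coset of `L` in its dual is parametrized by `L`. -/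
def cosetEquiv (y : Λ.dual) : L ≃ {x : Λ.dual // (x : Λ.Det) = y} :=
  Equiv.ofBijective
    (fun v => ⟨y + Λ.toDual v, by rw [QuotientAddGroup.mk_add, toDual_mk, add_zero]⟩) ⟨fun v w h => by
      have h1 : y + Λ.toDual v = y + Λ.toDual w := congrArg Subtype.val h
      exact Λ.tmul_one_injective (congrArg Subtype.val (add_left_cancel h1)), by
      rintro ⟨x, hx⟩
      obtain ⟨v, hv⟩ := QuotientAddGroup.eq.1 hx.symm
      refine ⟨v, Subtype.ext ?_⟩
      have : Λ.toDual v = -y + x := Subtype.ext hv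
      change y + Λ.toDual v = x
      rw [this]; abel⟩

theorem cosetTheta_mk (y : Λ.dual) (z : ℍ) :
    Λ.cosetTheta (y : Λ.Det) z = ∑' v : L, Λ.gaussTerm (y + (1 : ℚ) ⊗ₜ[ℤ] v) (z : ℂ) := by
  rw [cosetTheta_eq, ← (Λ.cosetEquiv y).tsum_eq]
  rfl

namespace OrthogonalFamily

variable {Λ} (B : Λ.OrthogonalFamily)

theorem exists_index (y : Λ.dual) : ∃ a, B.dualComb a = y := by
  choose m hm using y.2
  refine ⟨fun i => m (B.vec i), ?_⟩
  conv_rhs => rw [B.expand y]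
  simp only [hm]
  rfl

/-- The coordinates of a dual vector with respect to the dual family. -/
def index (y : Λ.dual) : Fin (Module.finrank ℤ L) → ℤ := (B.exists_index y).choose

theorem dualComb_index (y : Λ.dual) : B.dualComb (B.index y) = y := (B.exists_index y).choose_spec

theorem index_injective : Function.Injective B.index := fun y y' h => by
  refine Subtype.ext ?_
  rw [← dualComb_index B y, h, dualComb_index]

theorem dualComb_injective : Function.Injective B.dualComb := fun a a' h => by
  ext i
  have := B.formQ_dualComb_vec a i
  rw [h, formQ_dualComb_vec] at this
  exact_mod_cast this.symm

/-- The quotient of `L` by the sublattice is finite. -/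
theorem finite_quotient : Finite (L ⧸ B.lift.range) := by
  have : ∀ i, NeZero (B.sq i) := fun i => ⟨(B.sq_pos i).ne'⟩
  -- The pairings with the orthogonal vectors modulo their squares determine a class: if each
  -- pairing is divisible by the square, the orthogonal coordinates are integers.
  refine Finite.of_injective (fun (r : L ⧸ B.lift.range) (i : Fin (Module.finrank ℤ L)) =>
    ((Λ.form r.out (B.vec i) : ℤ) : ZMod (B.sq i))) fun r r' h => ?_
  rw [← QuotientAddGroup.out_eq' r, ← QuotientAddGroup.out_eq' r', QuotientAddGroup.eq]
  have hdvd : ∀ i, ∃ t : ℤ, Λ.form r'.out (B.vec i) - Λ.form r.out (B.vec i) = B.sq i * t :=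
    fun i => (ZMod.intCast_eq_intCast_iff_dvd_sub _ _ _).1 (congrFun h i)
  choose t ht using hdvd
  refine ⟨t, Λ.tmul_one_injective ?_⟩
  simp only
  rw [tmul_lift, ← B.comb_coord ((1 : ℚ) ⊗ₜ[ℤ] (-r.out + r'.out))]
  congr 1
  ext i
  rw [coord, formQ_tmul, map_add, map_neg, LinearMap.add_apply, LinearMap.neg_apply,
    neg_add_eq_sub, ht]
  have := B.sq_ne_zero i
  push_cast
  field_simp

/-- `L` as the union of the cosets of the sublattice. -/
def quotientProdEquiv : (L ⧸ B.lift.range) × (Fin (Module.finrank ℤ L) → ℤ) ≃ L :=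
  Equiv.ofBijective (fun p => p.1.out + B.lift p.2) ⟨fun ⟨r, a⟩ ⟨r', a'⟩ h => by
    have hmk : ∀ (s : L ⧸ B.lift.range) (c : Fin (Module.finrank ℤ L) → ℤ),
        ((s.out + B.lift c : L) : L ⧸ B.lift.range) = s := fun s c => by
      rw [QuotientAddGroup.mk_add, QuotientAddGroup.out_eq',
        (QuotientAddGroup.eq_zero_iff (N := B.lift.range) (B.lift c)).2 ⟨c, rfl⟩, add_zero]
    have h1 : r.out + B.lift a = r'.out + B.lift a' := h
    obtain rfl : r = r' := by rw [← hmk r a, h1, hmk]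
    rw [B.lift_injective (add_left_cancel h1)], fun v => by
    obtain ⟨⟨_, a, rfl⟩, ha⟩ := QuotientAddGroup.mk_out_eq_add B.lift.range v
    refine ⟨((v : L ⧸ B.lift.range), -a), ?_⟩
    simp only [ha, map_neg]
    abel⟩

end OrthogonalFamily

theorem summable_gaussTerm_dual (x : ℚ ⊗[ℤ] L) {z : ℂ} (hz : 0 < z.im) :
    Summable fun y : Λ.dual => Complex.exp (2 * Real.pi * Complex.I * (Λ.formQ x y : ℂ)) *
      Λ.gaussTerm y z := by
  obtain ⟨B⟩ := Λ.nonempty_orthogonalFamily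
  have := (B.summable_dualComb x hz).comp_injective B.index_injective
  simpa only [Function.comp_def, B.dualComb_index] using this

theorem tsum_dual_eq_sum_det {f : Λ.dual → ℂ} (hf : Summable f) :
    ∑' y, f y = ∑ ρ : Λ.Det, ∑' y : {y : Λ.dual // (y : Λ.Det) = ρ}, f y := by
  have h := Summable.tsum_sigma
    ((Equiv.sigmaFiberEquiv fun y : Λ.dual => (y : Λ.Det)).summable_iff.2 hf)
  rw [tsum_fintype (L := .unconditional _) (f := fun ρ : Λ.Det => _)] at h
  exact ((Equiv.sigmaFiberEquiv fun y : Λ.dual => (y : Λ.Det)).tsum_eq f).symm.trans h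

/-- Orthogonality of characters on L/M. Integrality of `y` on M makes the summand independent of the
representative, and the character is trivial exactly when `y` is dual to L. This sieves the dual of
L out of the larger dual of M. -/
theorem sum_exp_formQ_quotient (M : AddSubgroup L) [Fintype (L ⧸ M)] (y : ℚ ⊗[ℤ] L)
    (hy : ∀ v ∈ M, ∃ m : ℤ, Λ.formQ y ((1 : ℚ) ⊗ₜ[ℤ] v) = m) [Decidable (y ∈ Λ.dual)] :
    ∑ r : L ⧸ M, Complex.exp (2 * Real.pi * Complex.I * (Λ.formQ ((1 : ℚ) ⊗ₜ[ℤ] r.out) y : ℂ)) =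
      if y ∈ Λ.dual then (Fintype.card (L ⧸ M) : ℂ) else 0 := by
  set χ : L → ℂ := fun v =>
    Complex.exp (2 * Real.pi * Complex.I * (Λ.formQ ((1 : ℚ) ⊗ₜ[ℤ] v) y : ℂ)) with hχ
  have hadd : ∀ v w, χ (v + w) = χ v * χ w := by
    intro v w
    simp only [hχ]
    rw [← Complex.exp_add, TensorProduct.tmul_add, map_add, LinearMap.add_apply]
    push_cast
    ring_nf
  have hint : ∀ v, χ v = 1 ↔ ∃ m : ℤ, Λ.formQ y ((1 : ℚ) ⊗ₜ[ℤ] v) = m := by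
    intro v
    simp only [hχ]
    rw [Complex.exp_eq_one_iff, Λ.formQ_symm]
    refine exists_congr fun m => ?_
    rw [mul_comm (2 * (Real.pi : ℂ) * Complex.I), mul_left_inj' Complex.two_pi_I_ne_zero]
    constructor <;> intro h <;> exact_mod_cast h
  change ∑ r : L ⧸ M, χ r.out = _
  split_ifs with h
  · have h' : ∀ r : L ⧸ M, χ r.out = 1 := fun r => (hint _).2 (h _)
    simp [h']
  · obtain ⟨v, hv⟩ : ∃ v, ¬ ∃ m : ℤ, Λ.formQ y ((1 : ℚ) ⊗ₜ[ℤ] v) = m := by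
      by_contra! hc
      exact h hc
    have hout : ∀ w : L, χ ((w : L ⧸ M)).out = χ w := by
      intro w
      obtain ⟨m, hm⟩ := QuotientAddGroup.mk_out_eq_add M w
      rw [hm, hadd, (hint m).2 (hy m m.2), mul_one]
    -- Translating by a `v` with χ(v) ≠ 1 multiplies the sum by χ(v), so the sum vanishes.
    have h1 : ∑ r : L ⧸ M, χ r.out = χ v * ∑ r : L ⧸ M, χ r.out := by
      rw [Finset.mul_sum, ← Equiv.sum_comp (Equiv.addLeft (v : L ⧸ M))]
      refine Finset.sum_congr rfl fun r _ => ?_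
      rw [← hadd, ← hout (v + r.out), QuotientAddGroup.mk_add, QuotientAddGroup.out_eq']
      rfl
    have h2 : (χ v - 1) * ∑ r : L ⧸ M, χ r.out = 0 := by rw [sub_mul, one_mul, ← h1, sub_self]
    exact (mul_eq_zero.1 h2).resolve_left (sub_ne_zero.2 fun h => hv ((hint v).1 h))

open Classical in
/-- Poisson summation for a coset of the lattice. -/
theorem exists_tsum_gaussTerm_coset : ∃ C : ℝ, 0 < C ∧ ∀ (y : Λ.dual) (z : ℂ), 0 < z.im →
    ∑' v : L, Λ.gaussTerm (y + (1 : ℚ) ⊗ₜ[ℤ] v) (-z⁻¹) =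
      C * (((Complex.I / z) ^ (1 / 2 : ℂ))⁻¹) ^ Module.finrank ℤ L *
        ∑' x : Λ.dual, Complex.exp (2 * Real.pi * Complex.I * (Λ.formQ y x : ℂ)) *
          Λ.gaussTerm x z := by
  obtain ⟨B⟩ := Λ.nonempty_orthogonalFamily
  have := B.finite_quotient
  have : Fintype (L ⧸ B.lift.range) := Fintype.ofFinite _
  have hcard : 0 < Fintype.card (L ⧸ B.lift.range) := Fintype.card_pos
  -- The reciprocal volume comes from Poisson summation on each coset of the sublattice, the index
  -- from the character sum. Only positivity matters here; the square is determined later by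
  -- `inversion_const_sq`.
  refine ⟨B.vol⁻¹ * Fintype.card (L ⧸ B.lift.range), by have := B.vol_pos; positivity,
    fun y z hz => ?_⟩
  have hz' : 0 < (-z⁻¹).im := by
    have hz0 : z ≠ 0 := by rintro rfl; simp at hz
    have := Complex.normSq_pos.2 hz0
    rw [Complex.neg_im, Complex.inv_im, neg_div, neg_neg]
    positivity
  have hsum : Summable fun v : L => Λ.gaussTerm (y + (1 : ℚ) ⊗ₜ[ℤ] v) (-z⁻¹) := by
    have h1 := Λ.summable_gaussTerm_dual 0 hz'
    simp only [map_zero, LinearMap.zero_apply, Rat.cast_zero, mul_zero, Complex.exp_zero,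
      one_mul] at h1
    exact h1.comp_injective (i := fun v : L => y + Λ.toDual v) fun v w h =>
      Λ.tmul_one_injective (congrArg Subtype.val (add_left_cancel h))
  let e := B.quotientProdEquiv
  have he : ∀ r a, e (r, a) = r.out + B.lift a := fun r a => rfl
  have hprod := Summable.tsum_prod (e.summable_iff.2 hsum)
  rw [tsum_fintype (L := .unconditional _) (f := fun r : L ⧸ B.lift.range => _)] at hprod
  simp only [Function.comp_def] at hprod
  rw [← e.tsum_eq, hprod]
  have hr : ∀ r : L ⧸ B.lift.range,
      ∑' a, Λ.gaussTerm (y + (1 : ℚ) ⊗ₜ[ℤ] e (r, a)) (-z⁻¹) =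
      (B.vol : ℂ)⁻¹ * (((Complex.I / z) ^ (1 / 2 : ℂ))⁻¹) ^ Module.finrank ℤ L *
        ∑' a, Complex.exp (2 * Real.pi * Complex.I *
          (Λ.formQ (y + (1 : ℚ) ⊗ₜ[ℤ] r.out) (B.dualComb a) : ℂ)) *
          Λ.gaussTerm (B.dualComb a) z := by
    intro r
    rw [← B.tsum_gaussTerm_add_lift _ hz]
    refine tsum_congr fun a => ?_
    rw [he, TensorProduct.tmul_add, add_assoc]
  have hint : ∀ a, ∀ v ∈ B.lift.range, ∃ m : ℤ,
      Λ.formQ (B.dualComb a) ((1 : ℚ) ⊗ₜ[ℤ] v) = m := by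
    rintro a v ⟨c, rfl⟩
    refine ⟨∑ i, a i * c i, ?_⟩
    rw [B.tmul_lift, OrthogonalFamily.dualComb, B.formQ_comb_comb]
    push_cast
    refine Finset.sum_congr rfl fun i _ => ?_
    have := B.sq_ne_zero i
    field_simp
  rw [Finset.sum_congr rfl fun r _ => hr r, ← Finset.mul_sum,
    ← Summable.tsum_finsetSum fun r _ => B.summable_dualComb _ hz]
  have hterm : ∀ a, ∑ r : L ⧸ B.lift.range, Complex.exp (2 * Real.pi * Complex.I *
        (Λ.formQ (y + (1 : ℚ) ⊗ₜ[ℤ] r.out) (B.dualComb a) : ℂ)) * Λ.gaussTerm (B.dualComb a) z =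
      Fintype.card (L ⧸ B.lift.range) * if B.dualComb a ∈ Λ.dual then
        Complex.exp (2 * Real.pi * Complex.I * (Λ.formQ y (B.dualComb a) : ℂ)) *
          Λ.gaussTerm (B.dualComb a) z else 0 := by
    intro a
    have h1 := Λ.sum_exp_formQ_quotient B.lift.range (B.dualComb a) (hint a)
    rw [← Finset.sum_mul]
    have h2 : ∀ r : L ⧸ B.lift.range, Complex.exp (2 * Real.pi * Complex.I *
        (Λ.formQ (y + (1 : ℚ) ⊗ₜ[ℤ] r.out) (B.dualComb a) : ℂ)) =
        Complex.exp (2 * Real.pi * Complex.I * (Λ.formQ y (B.dualComb a) : ℂ)) *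
        Complex.exp (2 * Real.pi * Complex.I *
          (Λ.formQ ((1 : ℚ) ⊗ₜ[ℤ] r.out) (B.dualComb a) : ℂ)) := by
      intro r
      rw [← Complex.exp_add, map_add, LinearMap.add_apply]
      push_cast
      ring_nf
    rw [Finset.sum_congr rfl fun r _ => h2 r, ← Finset.mul_sum, h1]
    split_ifs <;> ring
  -- Indices whose vector is not dual to L contribute 0, so the sum over ℤⁿ collapses to the dual
  -- lattice.
  rw [tsum_congr hterm, tsum_mul_left, ← B.index_injective.tsum_eq]
  · have h3 : ∀ x : Λ.dual, (if B.dualComb (B.index x) ∈ Λ.dual then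
        Complex.exp (2 * Real.pi * Complex.I * (Λ.formQ y (B.dualComb (B.index x)) : ℂ)) *
          Λ.gaussTerm (B.dualComb (B.index x)) z else 0) =
        Complex.exp (2 * Real.pi * Complex.I * (Λ.formQ y x : ℂ)) * Λ.gaussTerm x z := by
      intro x
      rw [B.dualComb_index, if_pos x.2]
    rw [tsum_congr h3]
    push_cast
    ring
  · intro a ha
    have h4 : B.dualComb a ∈ Λ.dual := by
      by_contra h5
      exact ha (if_neg h5)
    exact ⟨⟨_, h4⟩, B.dualComb_injective (B.dualComb_index ⟨_, h4⟩)⟩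

/-- A branch of the square root of `-iz` on the upper half plane. -/
def rootFactor (z : ℍ) : ℂ := ((Complex.I / (z : ℂ)) ^ (1 / 2 : ℂ))⁻¹

theorem rootFactor_sq (z : ℍ) : rootFactor z ^ 2 = -Complex.I * z := by
  rw [rootFactor, inv_pow, ← Complex.cpow_nat_mul]
  rw [show ((2 : ℕ) : ℂ) * (1 / 2) = 1 by norm_num, Complex.cpow_one, inv_div, div_eq_mul_inv,
    Complex.inv_I]
  ring

/-- The theta inversion formula, with an unspecified positive constant. -/
theorem exists_cosetTheta_S : ∃ C : ℝ, 0 < C ∧ ∀ (ρ : Λ.Det) (z : ℍ),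
    Λ.cosetTheta ρ (ModularGroup.S • z) = C * rootFactor z ^ Module.finrank ℤ L *
      ∑ μ : Λ.Det, Λ.pairing ρ μ * Λ.cosetTheta μ z := by
  obtain ⟨C, hC, h⟩ := Λ.exists_tsum_gaussTerm_coset
  refine ⟨C, hC, fun ρ z => ?_⟩
  induction ρ using QuotientAddGroup.induction_on with | _ y
  have hS : ((ModularGroup.S • z : ℍ) : ℂ) = -(z : ℂ)⁻¹ := by
    rw [UpperHalfPlane.modular_S_smul]
    exact inv_neg
  rw [cosetTheta_mk, hS, h y z z.im_pos, rootFactor,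
    Λ.tsum_dual_eq_sum_det (Λ.summable_gaussTerm_dual y z.im_pos)]
  congr 1
  refine Finset.sum_congr rfl fun μ _ => ?_
  rw [cosetTheta_eq, ← tsum_mul_left]
  refine tsum_congr fun x => ?_
  rw [← pairing_mk, x.2]

theorem cosetTheta_T (ρ : Λ.Det) (z : ℍ) :
    Λ.cosetTheta ρ (ModularGroup.T • z) = expChar (Λ.discForm ρ) * Λ.cosetTheta ρ z := by
  rw [cosetTheta_eq, cosetTheta_eq, ← tsum_mul_left]
  refine tsum_congr fun x => ?_
  have hT : ((ModularGroup.T • z : ℍ) : ℂ) = 1 + z := by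
    rw [UpperHalfPlane.modular_T_smul]; simp
  have hq : expChar (Λ.discForm ρ) =
      Complex.exp (2 * Real.pi * Complex.I * ((Λ.formQ x.1 x.1 / 2 : ℚ) : ℂ)) := by
    rw [← expChar_coe, ← discForm_mk, x.2]
  rw [hT, hq, gaussTerm, gaussTerm, ← Complex.exp_add]
  congr 1
  push_cast
  ring

open Classical in
theorem tendsto_cosetTheta (ρ : Λ.Det) : Filter.Tendsto (Λ.cosetTheta ρ)
    UpperHalfPlane.atImInfty (nhds (if ρ = 0 then 1 else 0)) := by
  have hsum : Summable fun y : Λ.dual => ‖Λ.gaussTerm y Complex.I‖ := by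
    have h1 := (Λ.summable_gaussTerm_dual 0 (z := Complex.I) (by simp)).norm
    simpa using h1
  have hsum' := hsum.subtype {y : Λ.dual | (y : Λ.Det) = ρ}
  have hlim : (if ρ = 0 then (1 : ℂ) else 0) = ∑' y : {y : Λ.dual // (y : Λ.Det) = ρ},
      if y.1 = 0 then (1 : ℂ) else 0 := by
    split_ifs with h
    · rw [tsum_eq_single (⟨0, by rw [h]; rfl⟩ : {y : Λ.dual // (y : Λ.Det) = ρ})]
      · simp
      · intro y hy
        rw [if_neg fun h0 => hy (Subtype.ext h0)]
    · refine ((tsum_congr fun y => ?_).trans tsum_zero).symm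
      rw [if_neg]
      intro h0
      apply h
      rw [← y.2, h0]
      rfl
  rw [hlim]
  -- The modulus of each term decreases with Im z, so the values at i dominate for Im z ≥ 1.
  -- Termwise, only the zero vector survives in the limit.
  refine tendsto_tsum_of_dominated_convergence (bound := fun y : {y : Λ.dual // (y : Λ.Det) = ρ} =>
    ‖Λ.gaussTerm y.1 Complex.I‖) hsum' (fun y => ?_) ?_
  · rcases eq_or_ne y.1 0 with h0 | h0
    · rw [if_pos h0]
      refine tendsto_const_nhds.congr fun z => ?_
      simp [h0]
    · rw [if_neg h0, tendsto_zero_iff_norm_tendsto_zero]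
      have hpos : 0 < (Λ.formQ y.1 y.1 : ℝ) := by
        exact_mod_cast Λ.formQ_self_pos fun h => h0 (Subtype.ext h)
      have h2 : Filter.Tendsto (fun z : ℍ => Real.exp (-(Real.pi * (Λ.formQ y.1 y.1 : ℝ) * z.im)))
          UpperHalfPlane.atImInfty (nhds 0) := by
        refine Real.tendsto_exp_neg_atTop_nhds_zero.comp ?_
        exact (Filter.tendsto_comap : Filter.Tendsto UpperHalfPlane.im
          UpperHalfPlane.atImInfty Filter.atTop).const_mul_atTop (by positivity)
      refine h2.congr fun z => ?_
      exact (Λ.norm_gaussTerm _ _).symm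
  · rw [UpperHalfPlane.atImInfty, Filter.eventually_comap]
    filter_upwards [Filter.eventually_ge_atTop 1] with b hb z hz y
    change ‖Λ.gaussTerm y.1 (z : ℂ)‖ ≤ _
    rw [norm_gaussTerm, norm_gaussTerm, Real.exp_le_exp, Complex.I_im, neg_le_neg_iff]
    have h3 : (0 : ℝ) ≤ Λ.formQ y.1 y.1 := by exact_mod_cast Λ.formQ_self_nonneg _
    have h4 : 1 ≤ (z : ℂ).im := by rw [UpperHalfPlane.coe_im, hz]; exact hb
    exact mul_le_mul_of_nonneg_left h4 (by positivity)

end EvenLattice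

end

/-! ### The inversion constant and Milgram's formula -/

noncomputable section

namespace EvenLattice

theorem coe_S_smul (z : ℍ) : ((ModularGroup.S • z : ℍ) : ℂ) = -(z : ℂ)⁻¹ := by
  rw [UpperHalfPlane.modular_S_smul]
  exact inv_neg

theorem coe_T_smul (z : ℍ) : ((ModularGroup.T • z : ℍ) : ℂ) = 1 + z := by
  rw [UpperHalfPlane.modular_T_smul]
  simp

variable {L : Type*} [AddCommGroup L] [Module.Free ℤ L] [Module.Finite ℤ L] (Λ : EvenLattice L)

/-- The limit at i∞ reads off the coefficient of θ_0. This replaces a comparison of all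
coefficients, which is unavailable in general since θ_ρ = θ_{-ρ}. -/
theorem tendsto_sum_mul_cosetTheta (c : Λ.Det → ℂ) :
    Filter.Tendsto (fun z => ∑ μ, c μ * Λ.cosetTheta μ z) UpperHalfPlane.atImInfty
      (nhds (c 0)) := by
  classical
  have h := tendsto_finsetSum Finset.univ fun μ _ => (Λ.tendsto_cosetTheta μ).const_mul (c μ)
  convert h
  simp

/-- Apply the inversion formula twice, since S² acts trivially. Squaring removes the sign from the
choice of root, and the limit at i∞ gives 1 = C⁴|Det|², whose positive root is taken. -/
theorem inversion_const_sq {C : ℝ} (hC : 0 < C) (h : ∀ (ρ : Λ.Det) (z : ℍ),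
    Λ.cosetTheta ρ (ModularGroup.S • z) = C * rootFactor z ^ Module.finrank ℤ L *
      ∑ μ : Λ.Det, Λ.pairing ρ μ * Λ.cosetTheta μ z) :
    C ^ 2 * Fintype.card Λ.Det = 1 := by
  have key : ∀ z : ℍ, Λ.cosetTheta 0 z ^ 2 = C ^ 4 *
      (∑ ν, (∑ μ, Λ.pairing μ ν) * Λ.cosetTheta ν z) ^ 2 := by
    intro z
    have hSS : ModularGroup.S • ModularGroup.S • z = z := by
      ext
      rw [coe_S_smul, coe_S_smul, inv_neg, neg_neg, inv_inv]
    have h1 := h 0 (ModularGroup.S • z)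
    simp only [hSS, pairing_zero_left, one_mul, h] at h1
    rw [← Finset.mul_sum, Finset.sum_comm] at h1
    simp only [← Finset.sum_mul] at h1
    have hw : (rootFactor (ModularGroup.S • z) * rootFactor z) ^ 2 = 1 := by
      rw [mul_pow, rootFactor_sq, rootFactor_sq, coe_S_smul]
      have := z.ne_zero
      field_simp
      rw [Complex.I_sq]; ring
    have hwn : (rootFactor (ModularGroup.S • z) ^ Module.finrank ℤ L *
        rootFactor z ^ Module.finrank ℤ L) ^ 2 = 1 := by
      rw [← mul_pow, pow_right_comm, hw, one_pow]
    rw [h1]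
    linear_combination (C ^ 4 *
      (∑ ν, (∑ μ, Λ.pairing μ ν) * Λ.cosetTheta ν z) ^ 2) * hwn
  have hl : Filter.Tendsto (fun z => Λ.cosetTheta 0 z ^ 2) UpperHalfPlane.atImInfty (nhds 1) := by
    have := (Λ.tendsto_cosetTheta 0).pow 2
    simpa using this
  have hr := ((Λ.tendsto_sum_mul_cosetTheta fun ν => ∑ μ, Λ.pairing μ ν).pow 2).const_mul
    ((C : ℂ) ^ 4)
  have h2 := tendsto_nhds_unique (hl.congr key) hr
  simp only [pairing_zero_right, Finset.sum_const, Finset.card_univ, nsmul_eq_mul, mul_one] at h2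
  have h3 : (1 : ℝ) = C ^ 4 * (Fintype.card Λ.Det : ℝ) ^ 2 := by exact_mod_cast h2
  have h4 : 0 ≤ C ^ 2 * (Fintype.card Λ.Det : ℝ) := by positivity
  nlinarith [sq_nonneg (C ^ 2 * (Fintype.card Λ.Det : ℝ) - 1)]

theorem gaussSum_eq_sum : Λ.gaussSum = ∑ ρ, expChar (Λ.discForm ρ) :=
  finsum_eq_sum_of_fintype _

/-- Milgram's formula, up to an ambiguity of sign unless the exponent `e` removes it. -/
theorem inversion_const_mul_gaussSum {C : ℝ} (hC : 0 < C) (h : ∀ (ρ : Λ.Det) (z : ℍ),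
    Λ.cosetTheta ρ (ModularGroup.S • z) = C * rootFactor z ^ Module.finrank ℤ L *
      ∑ μ : Λ.Det, Λ.pairing ρ μ * Λ.cosetTheta μ z) {e j : ℕ}
    (hej : Module.finrank ℤ L * e = 2 * j) :
    (-Complex.I) ^ j * (C * Λ.gaussSum) ^ e = 1 := by
  have hC0 : (C : ℂ) ≠ 0 := by exact_mod_cast hC.ne'
  have key : ∀ z : ℍ, (∑ μ, 1 * Λ.cosetTheta μ z) ^ e = (-Complex.I) ^ j * (C : ℂ) ^ e *
      (∑ ν, (∑ μ, expChar (Λ.discForm μ) * Λ.pairing μ ν) * expChar (Λ.discForm ν) *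
        Λ.cosetTheta ν z) ^ e := by
    intro z
    set z' := ModularGroup.T • ModularGroup.S • ModularGroup.T • z with hz'
    have hz0 : (z : ℂ) ≠ 0 := z.ne_zero
    have hz1 : (1 : ℂ) + z ≠ 0 := by
      rw [← coe_T_smul]
      exact UpperHalfPlane.ne_zero _
    have hc' : (z' : ℂ) = z / (1 + z) := by
      rw [hz', coe_T_smul, coe_S_smul, coe_T_smul]
      field_simp
      ring
    have hrel : ModularGroup.S • z = ModularGroup.T • ModularGroup.S • z' := by
      ext
      rw [coe_T_smul, coe_S_smul, coe_S_smul, hc']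
      field_simp
      ring
    -- θ_0 is invariant under T. Inversion at z on the left and at z' on the right then expresses ∑
    -- θ_μ(z) in two ways, with χ as the θ_0-coefficient of the second.
    have h1 : Λ.cosetTheta 0 (ModularGroup.S • z) = Λ.cosetTheta 0 (ModularGroup.S • z') := by
      rw [hrel, cosetTheta_T, discForm_zero, expChar_zero, one_mul]
    rw [h, h, hz'] at h1
    simp only [cosetTheta_T, h, pairing_zero_left, one_mul] at h1
    rw [← hz'] at h1
    have h2 : ∑ μ, expChar (Λ.discForm μ) * (C * rootFactor (ModularGroup.T • z) ^
        Module.finrank ℤ L * ∑ ν, Λ.pairing μ ν * (expChar (Λ.discForm ν) * Λ.cosetTheta ν z)) =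
        C * rootFactor (ModularGroup.T • z) ^ Module.finrank ℤ L *
        ∑ ν, (∑ μ, expChar (Λ.discForm μ) * Λ.pairing μ ν) * expChar (Λ.discForm ν) *
        Λ.cosetTheta ν z := by
      simp only [Finset.mul_sum, Finset.sum_mul]
      rw [Finset.sum_comm]
      refine Finset.sum_congr rfl fun ν _ => Finset.sum_congr rfl fun μ _ => ?_
      ring
    rw [h2, mul_assoc, mul_assoc, mul_right_inj' hC0] at h1
    -- The e-th power leaves only even powers of `rootFactor`, which are powers of -iz, so the
    -- branch no longer matters.
    have h3 := congrArg (fun t => t ^ e) h1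
    simp only [mul_pow, ← pow_mul, hej] at h3
    simp only [pow_mul, rootFactor_sq, hc', coe_T_smul] at h3
    simp only [one_mul]
    have hIz : (-Complex.I * (z : ℂ)) ^ j ≠ 0 :=
      pow_ne_zero _ (mul_ne_zero (neg_ne_zero.2 Complex.I_ne_zero) hz0)
    rw [← mul_right_inj' hIz, h3]
    have h4 : (-Complex.I * (z / (1 + z) : ℂ)) ^ j * (-Complex.I * (1 + z : ℂ)) ^ j =
        (-Complex.I * z) ^ j * (-Complex.I) ^ j := by
      rw [← mul_pow, ← mul_pow]
      congr 1
      field_simp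
    linear_combination (C : ℂ) ^ e * (∑ ν, (∑ μ, expChar (Λ.discForm μ) * Λ.pairing μ ν) *
      expChar (Λ.discForm ν) * Λ.cosetTheta ν z) ^ e * h4
  have hl := (Λ.tendsto_sum_mul_cosetTheta fun _ => 1).pow e
  have hr := ((Λ.tendsto_sum_mul_cosetTheta fun ν =>
    (∑ μ, expChar (Λ.discForm μ) * Λ.pairing μ ν) * expChar (Λ.discForm ν)).pow e).const_mul
    ((-Complex.I) ^ j * (C : ℂ) ^ e)
  have h5 := tendsto_nhds_unique (hl.congr key) hr
  simp only [pairing_zero_right, mul_one, discForm_zero, expChar_zero, ← gaussSum_eq_sum] at h5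
  rw [mul_pow, ← mul_assoc, ← h5, one_pow]

/-! ### Congruences modulo ℓ: the rank and the action of SL₂(ℤ) -/

variable {Λ}

theorem autPerm_apply_eq_iff {σ : Λ.autGroup} (hfix : detFixed σ = ⊥) (ρ : Λ.Det) :
    Λ.autPerm σ ρ = ρ ↔ ρ = 0 := by
  rw [← AddSubgroup.mem_bot, ← hfix]
  rfl

theorem sum_det_eq {M : Type*} [AddCommGroup M] {ℓ : ℕ} (hℓ : ℓ.Prime) {σ : Λ.autGroup}
    (hσ : ∃ m : ℕ, orderOf σ = ℓ ^ m) (hfix : detFixed σ = ⊥) (f : Λ.Det → M)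
    (hf : ∀ ρ, f (autDet σ ρ) = f ρ) : ∃ w : M, ∑ ρ, f ρ = f 0 + ℓ • w := by
  obtain ⟨m, hm⟩ := hσ
  refine sum_eq_add_nsmul_of_perm (m := m) hℓ (Λ.autPerm σ) ?_ 0 (autPerm_apply_eq_iff hfix) f hf
  rw [← map_pow, ← hm, pow_orderOf_eq_one, map_one]

/-- The ring is left open because the congruence is needed twice: among algebraic integers for the
rank, and in O_L for the theta series. -/
theorem gaussSum_eq_one_add {ℓ : ℕ} (hℓ : ℓ.Prime) {σ : Λ.autGroup}
    (hσ : ∃ m : ℕ, orderOf σ = ℓ ^ m) (hfix : detFixed σ = ⊥) (R : Subalgebra ℤ ℂ)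
    (hR : ∀ ρ, expChar (Λ.discForm ρ) ∈ R) : ∃ a ∈ R, Λ.gaussSum = 1 + ℓ * a := by
  obtain ⟨a, ha⟩ := sum_det_eq hℓ hσ hfix (fun ρ => (⟨_, hR ρ⟩ : R)) fun ρ =>
    Subtype.ext (by simp only [discForm_autDet])
  refine ⟨a, a.2, ?_⟩
  have := congrArg (fun x : R => (x : ℂ)) ha
  simp only [AddSubmonoidClass.coe_finsetSum, discForm_zero, expChar_zero] at this
  rw [gaussSum_eq_sum, this]
  simp

/-- If the square of an algebraic integer congruent to `1`, times a power of `-i`, is an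
integer congruent to `1` modulo a prime `p ≥ 3`, the exponent is divisible by `4`. -/
theorem four_dvd_of_negI_pow {p : ℕ} (hp : p.Prime) (hp3 : 3 ≤ p) {n : ℕ} {a b : ℂ}
    (ha : IsIntegral ℤ a) (hb : IsIntegral ℤ b)
    (h : (-Complex.I) ^ n * (1 + p * a) ^ 2 = 1 + p * b) : 4 ∣ n := by
  have hI : IsIntegral ℤ Complex.I := by
    refine ⟨Polynomial.X ^ 2 + 1, by monicity!, ?_⟩
    simp
  have hpI : IsIntegral ℤ (p : ℂ) := isIntegral_natCast p
  have h1 : (-Complex.I) ^ n - 1 = p * (b - (-Complex.I) ^ n * (2 * a + p * a ^ 2)) := by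
    linear_combination h
  have hc : IsIntegral ℤ (b - (-Complex.I) ^ n * (2 * a + p * a ^ 2)) := by
    rw [two_mul]
    exact hb.sub ((hI.neg.pow n).mul ((ha.add ha).add (hpI.mul (ha.pow 2))))
  set c := b - (-Complex.I) ^ n * (2 * a + p * a ^ 2)
  have hI4 : (-Complex.I) ^ 4 = 1 := by rw [neg_pow, Complex.I_pow_four]; norm_num
  have h2 : (-Complex.I) ^ n = (-Complex.I) ^ (n % 4) := by
    conv_lhs => rw [← Nat.div_add_mod n 4, pow_add, pow_mul, hI4, one_pow, one_mul]
  rw [h2] at h1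
  have h3 : n % 4 < 4 := Nat.mod_lt _ (by norm_num)
  have hII := Complex.I_sq
  refine Nat.dvd_of_mod_eq_zero ?_
  -- In each nonzero residue class, (-i)^n - 1 divides 2 in ℤ[i]; the cofactors are -1 + i, -1 and
  -- -1 - i. So p times an algebraic integer would be 2.
  interval_cases hn : n % 4
  · rfl
  · exact absurd (by linear_combination (-1 + Complex.I) * h1 + hII)
      (not_two_eq_prime_mul_isIntegral hp hp3 (hc.mul (isIntegral_one.neg.add hI)))
  · exact absurd (by linear_combination -h1 + hII)
      (not_two_eq_prime_mul_isIntegral hp hp3 hc.neg)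
  · exact absurd (by linear_combination (-1 - Complex.I) * h1 +
      (1 - Complex.I ^ 2 - Complex.I) * hII)
      (not_two_eq_prime_mul_isIntegral hp hp3 (hc.mul (isIntegral_one.neg.sub hI)))

theorem sum_smul_slash (k : ℤ) (A : SL(2, ℤ)) (c : Λ.Det → ℂ) (f : Λ.Det → ℍ → ℂ) :
    (∑ ρ, c ρ • f ρ) ∣[k] A = ∑ ρ, c ρ • (f ρ ∣[k] A) := by
  ext z
  simp only [ModularForm.SL_slash_apply, Finset.sum_apply, Pi.smul_apply, smul_eq_mul,
    Finset.sum_mul, mul_assoc]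

theorem cosetTheta_slash_T (k : ℤ) (ρ : Λ.Det) :
    Λ.cosetTheta ρ ∣[k] ModularGroup.T = expChar (Λ.discForm ρ) • Λ.cosetTheta ρ := by
  ext z
  rw [ModularForm.SL_slash_apply, cosetTheta_T]
  have hd : UpperHalfPlane.denom ModularGroup.T z = 1 := by
    rw [ModularGroup.denom_apply]
    simp [ModularGroup.T]
  rw [hd, one_zpow, mul_one]
  rfl

theorem cosetTheta_slash_T_inv (k : ℤ) (ρ : Λ.Det) :
    Λ.cosetTheta ρ ∣[k] ModularGroup.T⁻¹ = (expChar (Λ.discForm ρ))⁻¹ • Λ.cosetTheta ρ := by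
  have h1 : (Λ.cosetTheta ρ ∣[k] ModularGroup.T) ∣[k] ModularGroup.T⁻¹ = Λ.cosetTheta ρ := by
    rw [← SlashAction.slash_mul, mul_inv_cancel, SlashAction.slash_one]
  rw [cosetTheta_slash_T, ModularForm.SL_smul_slash] at h1
  have h0 : expChar (Λ.discForm ρ) ≠ 0 := by
    intro h0
    have := expChar_add (Λ.discForm ρ) (-Λ.discForm ρ)
    rw [h0, zero_mul, add_neg_cancel, expChar_zero] at this
    exact one_ne_zero this
  rw [eq_inv_smul_iff₀ h0, h1]

/-- The rank and the theta inversion formula, in the presence of an automorphism of prime power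
order without fixed points on `Det(L)`. -/
theorem exists_rank_and_slash_S {ℓ : ℕ} (hℓ : ℓ.Prime) (hℓ3 : 3 ≤ ℓ) {σ : Λ.autGroup}
    (hσ : ∃ m : ℕ, orderOf σ = ℓ ^ m) (hfix : detFixed σ = ⊥) :
    Λ.gaussSum ≠ 0 ∧ ∃ j : ℕ, Module.finrank ℤ L = 4 * j ∧ ∀ ρ : Λ.Det,
      Λ.cosetTheta ρ ∣[(2 * j : ℤ)] ModularGroup.S =
        Λ.gaussSum⁻¹ • ∑ μ, Λ.pairing ρ μ • Λ.cosetTheta μ := by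
  obtain ⟨C, hC, h⟩ := Λ.exists_cosetTheta_S
  have hcard := Λ.inversion_const_sq hC h
  have hcard' : (C : ℂ) ^ 2 * Fintype.card Λ.Det = 1 := by exact_mod_cast hcard
  have hC0 : (C : ℂ) ≠ 0 := by exact_mod_cast hC.ne'
  obtain ⟨b, hb⟩ := sum_det_eq hℓ hσ hfix (fun _ : Λ.Det => (1 : ℤ)) fun _ => rfl
  obtain ⟨a, ha, hχ⟩ := gaussSum_eq_one_add hℓ hσ hfix (integralClosure ℤ ℂ)
    Λ.isIntegral_expChar_discForm
  have hb' : (Fintype.card Λ.Det : ℂ) = 1 + ℓ * (b : ℂ) := by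
    have h1 : (Fintype.card Λ.Det : ℤ) = 1 + ℓ * b := by simpa using hb
    exact_mod_cast h1
  -- With e = 2 the formula holds for any rank. Cancelling C² against C²|Det| = 1 leaves (-i)^n χ² =
  -- |Det|, and both χ and |Det| are congruent to 1.
  have h2 := Λ.inversion_const_mul_gaussSum hC h (mul_comm (Module.finrank ℤ L) 2)
  obtain ⟨j, hj⟩ : 4 ∣ Module.finrank ℤ L := by
    refine four_dvd_of_negI_pow hℓ hℓ3 ha (isIntegral_intCast (n := b)) ?_
    rw [← hχ, ← hb']
    refine mul_left_cancel₀ (pow_ne_zero 2 hC0) ?_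
    rw [hcard', ← h2]
    ring
  -- Once 4 divides the rank, e = 1 is allowed and fixes the sign: χ⁻¹ = (-1)^j C. The same sign
  -- arises from the 4j-th power of `rootFactor`, so the two cancel.
  have h3 := Λ.inversion_const_mul_gaussSum hC h (e := 1) (j := 2 * j) (by omega)
  have hI : (-Complex.I) ^ (2 * j) = (-1) ^ j := by rw [pow_mul, neg_sq, Complex.I_sq]
  rw [hI, pow_one] at h3
  have hχ0 : Λ.gaussSum ≠ 0 := by
    intro h0
    rw [h0, mul_zero, mul_zero] at h3
    exact zero_ne_one h3
  have hinv : Λ.gaussSum⁻¹ = (-1) ^ j * C := inv_eq_of_mul_eq_one_left (by rw [mul_assoc, h3])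
  refine ⟨hχ0, j, hj, fun ρ => ?_⟩
  ext z
  have hz0 : (z : ℂ) ≠ 0 := z.ne_zero
  have hw : rootFactor z ^ Module.finrank ℤ L = (-1) ^ j * (z : ℂ) ^ (2 * j) := by
    rw [hj, show 4 * j = 2 * (2 * j) by ring, pow_mul, rootFactor_sq, mul_pow, hI]
  rw [ModularForm.SL_slash_apply, h, hw, hinv, ModularGroup.denom_S]
  simp only [Pi.smul_apply, Finset.sum_apply, smul_eq_mul]
  have hz : (z : ℂ) ^ (2 * j) * (z : ℂ) ^ (-(2 * j : ℤ)) = 1 := by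
    rw [zpow_neg]
    exact mul_inv_cancel₀ (pow_ne_zero _ hz0)
  linear_combination (C * (-1) ^ j * ∑ μ, Λ.pairing ρ μ * Λ.cosetTheta μ z) * hz

/-- The functions `∑ c_ρ θ_ρ` with `σ`-invariant coefficients in `O_L` and `c₀ ≡ 1 mod ℓ`. -/
def IsNormalized (ℓ : ℕ) (σ : Λ.autGroup) (f : ℍ → ℂ) : Prop :=
  ∃ c : Λ.Det → ℂ, (∀ ρ, c ρ ∈ Λ.coeffRing) ∧ (∀ ρ, c (autDet σ ρ) = c ρ) ∧
    (∃ d ∈ Λ.coeffRing, c 0 = 1 + ℓ * d) ∧ f = ∑ ρ, c ρ • Λ.cosetTheta ρ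

theorem isNormalized_theta (ℓ : ℕ) {σ : Λ.autGroup} (hfix : detFixed σ = ⊥) :
    IsNormalized ℓ σ Λ.theta := by
  classical
  refine ⟨fun ρ => if ρ = 0 then 1 else 0, fun ρ => ?_, fun ρ => ?_,
    ⟨0, zero_mem _, by simp⟩, ?_⟩
  · dsimp only
    split_ifs
    exacts [one_mem _, zero_mem _]
  · have : autDet σ ρ = 0 ↔ ρ = 0 := by
      rw [← autPerm_apply]
      conv_lhs => rw [← (autPerm_apply_eq_iff hfix 0).2 rfl]
      exact (Λ.autPerm σ).injective.eq_iff
    simp only [this]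
  · rw [theta_eq_cosetTheta_zero]
    simp

theorem IsNormalized.slash_diagonal {ℓ : ℕ} {σ : Λ.autGroup} {f : ℍ → ℂ} {k : ℤ} {A : SL(2, ℤ)}
    (hf : IsNormalized ℓ σ f) (u : Λ.Det → ℂ) (hu : ∀ ρ, u ρ ∈ Λ.coeffRing) (hu0 : u 0 = 1)
    (hinv : ∀ ρ, u (autDet σ ρ) = u ρ)
    (hA : ∀ ρ, Λ.cosetTheta ρ ∣[k] A = u ρ • Λ.cosetTheta ρ) : IsNormalized ℓ σ (f ∣[k] A) := by
  obtain ⟨c, hc, hcσ, hc0, rfl⟩ := hf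
  refine ⟨fun ρ => c ρ * u ρ, fun ρ => mul_mem (hc ρ) (hu ρ), fun ρ => ?_, ?_, ?_⟩
  · simp only [hcσ, hinv]
  · simpa only [hu0, mul_one] using hc0
  · rw [sum_smul_slash]
    simp only [hA, smul_smul]

/-- The new coefficient at 0 is χ⁻¹ ∑ c_ρ. Both χ and ∑ c_ρ are congruent to 1 modulo ℓ, by the
orbit count, and χ is a unit of O_L. Invariance persists because `σ` preserves the pairing. -/
theorem IsNormalized.slash_S {ℓ : ℕ} (hℓ : ℓ.Prime) {σ : Λ.autGroup}
    (hσ : ∃ m : ℕ, orderOf σ = ℓ ^ m) (hfix : detFixed σ = ⊥) {f : ℍ → ℂ} {k : ℤ}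
    (hf : IsNormalized ℓ σ f) (hχ0 : Λ.gaussSum ≠ 0)
    (hS : ∀ ρ : Λ.Det, Λ.cosetTheta ρ ∣[k] ModularGroup.S =
        Λ.gaussSum⁻¹ • ∑ μ, Λ.pairing ρ μ • Λ.cosetTheta μ) :
    IsNormalized ℓ σ (f ∣[k] ModularGroup.S) := by
  obtain ⟨c, hc, hcσ, ⟨d, hd, hcd⟩, rfl⟩ := hf
  obtain ⟨a, ha, hχ⟩ := gaussSum_eq_one_add hℓ hσ hfix Λ.coeffRing Λ.expChar_discForm_mem
  obtain ⟨w, hw⟩ := sum_det_eq hℓ hσ hfix (fun ρ => (⟨c ρ, hc ρ⟩ : Λ.coeffRing)) fun ρ =>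
    Subtype.ext (hcσ ρ)
  have hw' : ∑ ρ, c ρ = 1 + ℓ * d + ℓ * (w : ℂ) := by
    have := congrArg (fun x : Λ.coeffRing => (x : ℂ)) hw
    simp only [AddSubmonoidClass.coe_finsetSum] at this
    rw [this, ← hcd]
    simp
  refine ⟨fun μ => Λ.gaussSum⁻¹ * ∑ ρ, c ρ * Λ.pairing ρ μ, fun μ =>
    mul_mem Λ.gaussSum_inv_mem (sum_mem fun ρ _ => mul_mem (hc ρ) (Λ.pairing_mem ρ μ)),
    fun μ => ?_, ⟨Λ.gaussSum⁻¹ * (d + w - a),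
      mul_mem Λ.gaussSum_inv_mem (sub_mem (add_mem hd w.2) ha), ?_⟩, ?_⟩
  · simp only
    rw [← Equiv.sum_comp (Λ.autPerm σ)]
    simp only [autPerm_apply, hcσ, pairing_autDet]
  · simp only [pairing_zero_right, mul_one, hw']
    field_simp
    rw [hχ]
    ring
  · rw [sum_smul_slash]
    simp only [hS, Finset.smul_sum, Finset.mul_sum, Finset.sum_smul, smul_smul]
    rw [Finset.sum_comm]
    refine Finset.sum_congr rfl fun μ _ => Finset.sum_congr rfl fun ρ _ => ?_
    congr 1
    ring

/-- Since θ_ρ is itself `σ`-invariant, so is ρ ↦ c_ρ θ_ρ. The orbit count with values in W_L leaves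
only c_0 θ_0, which is θ_L modulo ℓ. -/
theorem IsNormalized.exists_mem_thetaSpan {ℓ : ℕ} (hℓ : ℓ.Prime) {σ : Λ.autGroup}
    (hσ : ∃ m : ℕ, orderOf σ = ℓ ^ m) (hfix : detFixed σ = ⊥) {f : ℍ → ℂ}
    (hf : IsNormalized ℓ σ f) : ∃ w ∈ Λ.thetaSpan, f - Λ.theta = (ℓ : ℂ) • w := by
  obtain ⟨c, hc, hcσ, ⟨d, hd, hcd⟩, rfl⟩ := hf
  have hmem : ∀ (t : ℂ) (_ : t ∈ Λ.coeffRing) (ρ : Λ.Det), t • Λ.cosetTheta ρ ∈ Λ.thetaSpan :=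
    fun t ht ρ => Λ.thetaSpan.smul_mem (⟨t, ht⟩ : Λ.coeffRing) (Submodule.subset_span ⟨ρ, rfl⟩)
  obtain ⟨w, hw⟩ := sum_det_eq hℓ hσ hfix
    (fun ρ => (⟨c ρ • Λ.cosetTheta ρ, hmem _ (hc ρ) ρ⟩ : Λ.thetaSpan)) fun ρ =>
      Subtype.ext (by simp only [hcσ, cosetTheta_autDet])
  have hw' : ∑ ρ, c ρ • Λ.cosetTheta ρ = c 0 • Λ.cosetTheta 0 + ℓ • (w : ℍ → ℂ) := by
    have := congrArg (fun x : Λ.thetaSpan => (x : ℍ → ℂ)) hw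
    simpa only [AddSubmonoidClass.coe_finsetSum, Submodule.coe_add, Submodule.coe_smul_of_tower]
      using this
  refine ⟨d • Λ.cosetTheta 0 + w, add_mem (hmem d hd 0) w.2, ?_⟩
  rw [hw', hcd, theta_eq_cosetTheta_zero, ← Nat.cast_smul_eq_nsmul ℂ]
  ext z
  simp only [Pi.sub_apply, Pi.add_apply, Pi.smul_apply, smul_eq_mul]
  ring

end EvenLattice

end

/-! ### The congruence for θ_L -/

theorem mainTheorem8 (ℓ : ℕ) (hℓ : ℓ.Prime) (hℓ5 : 5 ≤ ℓ)
    {L : Type*} [AddCommGroup L] [Module.Free ℤ L] [Module.Finite ℤ L] (Λ : EvenLattice L)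
    (σ : Λ.autGroup) (hσ : ∃ m : ℕ, orderOf σ = ℓ ^ m)
    (hfix : EvenLattice.detFixed σ = ⊥) :
    ∃ k : ℤ, (Module.finrank ℤ L : ℤ) = 2 * k ∧ Even k ∧
      ∀ A : SL(2, ℤ), ∃ w ∈ Λ.thetaSpan, Λ.theta ∣[k] A - Λ.theta = (ℓ : ℂ) • w := by
  obtain ⟨hχ0, j, hj, hS⟩ := EvenLattice.exists_rank_and_slash_S hℓ (by omega) hσ hfix
  refine ⟨2 * j, by rw [hj]; push_cast; ring, even_two_mul _, fun A => ?_⟩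
  have key : ∀ f, EvenLattice.IsNormalized ℓ σ f →
      EvenLattice.IsNormalized ℓ σ (f ∣[(2 * j : ℤ)] A) := by
    have hST : ∀ f, EvenLattice.IsNormalized ℓ σ f →
        EvenLattice.IsNormalized ℓ σ (f ∣[(2 * j : ℤ)] ModularGroup.S) := fun f hf =>
      hf.slash_S hℓ hσ hfix hχ0 hS
    have hA : A ∈ Subgroup.closure {ModularGroup.S, ModularGroup.T} := by
      rw [SpecialLinearGroup.SL2Z_generators]
      exact Subgroup.mem_top A
    induction hA using Subgroup.closure_induction'' with
    | mem x hx =>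
      rcases hx with rfl | rfl
      · exact hST
      · exact fun f hf => hf.slash_diagonal _ Λ.expChar_discForm_mem
          (by rw [EvenLattice.discForm_zero, EvenLattice.expChar_zero])
          (fun ρ => by rw [EvenLattice.discForm_autDet]) (EvenLattice.cosetTheta_slash_T _)
    | inv_mem x hx =>
      rcases hx with rfl | rfl
      -- S has order 4, so its inverse needs no separate formula; T has infinite order, and its
      -- inverse is treated as another diagonal action.
      · have h3 : ModularGroup.S⁻¹ = ModularGroup.S * ModularGroup.S * ModularGroup.S := by
          decide
        intro f hf
        rw [h3, SlashAction.slash_mul, SlashAction.slash_mul]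
        exact hST _ (hST _ (hST _ hf))
      · exact fun f hf => hf.slash_diagonal _ Λ.expChar_discForm_inv_mem
          (by rw [EvenLattice.discForm_zero, EvenLattice.expChar_zero, inv_one])
          (fun ρ => by rw [EvenLattice.discForm_autDet]) (EvenLattice.cosetTheta_slash_T_inv _)
    | one => exact fun f hf => by rwa [SlashAction.slash_one]
    | mul x y _ _ hx hy =>
      intro f hf
      rw [SlashAction.slash_mul]
      exact hy _ (hx _ hf)
  exact (key _ (EvenLattice.isNormalized_theta ℓ hfix)).exists_mem_thetaSpan hℓ hσ hfix
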